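/- **Conventions.** Let $p$ be a prime. Composition and conjugation are written from left to right, $x^g=g^{-1}xg$. A *partial group* is a set $\mathcal L$ with an involution $g\mapsto g^{-1}$, a set $\mathbf D$ of words in $\mathcal L$ containing all words of length one and closed under subwords of consecutive letters, and a product $\Pi:\mathbf D\to\mathcal L$ with $\Pi(g)=g$, such that $u\circ v\circ w\in\mathbf D$ implies $u\circ\Pi(v)\circ w\in\mathbf D$ with the same product, and such that $w\in\mathbf D$ implies $w^{-1}\circ w\in\mathbf D$ with product $\mathbf 1=\Pi(\emptyset)$. A *subgroup* is a subset closed under inversion and products, all of whose words lie in $\mathbf D$. For $g\in\mathcal L$, $x^g=\Pi(g^{-1},x,g)$ is defined if $(g^{-1},x,g)\in\mathbf D$. A *locality* $(\mathcal L,\Delta,S)$ consists of a partial group $\mathcal L$, a $p$-subgroup $S$ of $\mathcal L$ that is maximal among the $p$-subgroups of $\mathcal L$, and a set $\Delta$ of subgroups of $S$ with $S\in\Delta$, such that: a word $(g_1,\dots,g_n)$ is in $\mathbf D$ if and only if there are $P_0,\dots,P_n\in\Delta$ with $P_{i-1}^{g_i}=P_i$ for all $i$; every subgroup of $S$ containing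 a conjugate $X^g$ ($g\in\mathcal L$) of some $X\in\Delta$ is in $\Delta$; and the poset of all intersections of non-empty families of sets $S_w$ has bounded chain lengths, where for a word $w$, $S_w$ is the set of all $x\in S$ that are conjugated successively into $S$ by the letters of $w$. For $P,Q\in\Delta$ let $N_{\mathcal L}(P,Q)$ be the set of all $g\in\mathcal L$ such that $x^g$ is defined and lies in $Q$ for all $x\in P$, and for $g$ in this set let $c_g:P\to Q$ be the homomorphism $x\mapsto x^g$. Put $N_{\mathcal L}(P)=\{g\mid P^g=P\}$ (a subgroup), $C_{\mathcal L}(P)=\{g\mid x^g=x\ \forall x\in P\}$, $N_S(P,Q)=\{s\in S\mid P^s\le Q\}$, $N_S(P)=\{s\in S\mid P^s=P\}$. The *fusion system of* $\mathcal L$ is the fusion system $\mathcal F=\mathcal F_S(\mathcal L)$ on $S$ generated by all $c_g:P\to Q$ with $P,Q\in\Delta$ and $g\in N_{\mathcal L}(P,Q)$, and $\mathcal L$ is then said to be *on* $\mathcal F$. A group is *virtually $p$-toral* if it has a subgroup of finite index isomorphic to a finite direct power of the Prüfer group $\mathbb Z(p^\infty)$. The locality is *compact* if: every $P\le S$ with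 $C_S(Q)\le Q$ for all $\mathcal F$-conjugates $Q$ of $P$ and with $O_p(\mathrm{Out}_{\mathcal F}(P))=1$ is in $\Delta$; for every $P\in\Delta$ the group $G=N_{\mathcal L}(P)$ is virtually $p$-toral and satisfies $C_G(O_p(G))\le O_p(G)$; and $X<N_Y(X)$ for all subgroups $X<Y$ of $S$. Let $\mathcal T=\mathcal T_\Delta(\mathcal L)$ be the category with object set $\Delta$ and $\mathrm{Mor}_{\mathcal T}(P,Q)=N_{\mathcal L}(P,Q)$, with composition $(g:P\to Q)\circ(h:Q\to R)=\Pi(g,h)$, and let $\mathcal T_\Delta(S)$ be the category with object set $\Delta$ and morphism sets $N_S(P,Q)$. Let $\epsilon:\mathcal T_\Delta(S)\to\mathcal T$ be the functor that is the identity on objects and is given on morphisms by the inclusions $\epsilon_{P,Q}:N_S(P,Q)\to N_{\mathcal L}(P,Q)$, and let $\rho:\mathcal T\to\mathcal F$ be the functor that is the inclusion on objects and sends $g$ to $c_g$. Write $\epsilon_P=\epsilon_{P,P}$, $\rho_P=\rho_{P,P}:\mathrm{Aut}_{\mathcal T}(P)\to\mathrm{Aut}_{\mathcal F}(P)$, and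 $\iota_{P,Q}=(\mathbf 1)\epsilon_{P,Q}$ for $P\le Q$ in $\Delta$. **Proposition.** Let $(\mathcal L,\Delta,S)$ be a compact locality on $\mathcal F$. For every $P\in\Delta$, every $\mathcal T$-endomorphism of $P$ is an automorphism, $g\mapsto(g:P\to P)$ is an isomorphism $N_{\mathcal L}(P)\to\mathrm{Aut}_{\mathcal T}(P)$, and it maps $C_{\mathcal L}(P)$ onto $\mathrm{Ker}(\rho_P)$. Moreover: * (A1) $\epsilon$ is the identity on objects and $\rho$ is the inclusion on objects. * (A2) For all $P,Q\in\Delta$ the group $\mathrm{Ker}(\rho_P)$ acts freely on $\mathrm{Mor}_{\mathcal T}(P,Q)$ from the left by composition, and $\rho_{P,Q}:\mathrm{Mor}_{\mathcal T}(P,Q)\to\mathrm{Hom}_{\mathcal F}(P,Q)$ is the orbit map for this action (it is surjective and its fibres are the orbits). Also, $\mathrm{Ker}(\rho_Q)$ acts freely on $\mathrm{Mor}_{\mathcal T}(P,Q)$ from the right. * (B) For all $P,Q\in\Delta$ the map $\epsilon_{P,Q}$ is injective, and $\epsilon_{P,Q}\circ\rho_{P,Q}$ sends $s\in N_S(P,Q)$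 to $c_s\in\mathrm{Hom}_{\mathcal F}(P,Q)$. * (C) For all $\phi\in\mathrm{Mor}_{\mathcal T}(P,Q)$ and all $x\in P$, with $y\in Q$ the image of $x$ under $\rho(\phi)$, we have $(x)\epsilon_P\circ\phi=\phi\circ(y)\epsilon_Q$. * (I) Each $\mathcal F$-conjugacy class of subgroups in $\Delta$ contains a subgroup $P$ such that the image of $N_S(P)$ under $\epsilon_P$ is a Sylow $p$-subgroup of $\mathrm{Aut}_{\mathcal T}(P)$, i.e. a $p$-subgroup of finite index relatively prime to $p$. * (II) Let $\phi:P\to Q$ be a $\mathcal T$-isomorphism, let $P\trianglelefteq\bar P\le S$ and $Q\trianglelefteq\bar Q\le S$, and suppose that the map $c_\phi:\mathrm{Aut}_{\mathcal T}(P)\to\mathrm{Aut}_{\mathcal T}(Q)$, $\alpha\mapsto\phi^{-1}\circ\alpha\circ\phi$, sends $(\bar P)\epsilon_P$ into $(\bar Q)\epsilon_Q$. Then $\bar P,\bar Q\in\Delta$ and there is $\bar\phi\in\mathrm{Mor}_{\mathcal T}(\bar P,\bar Q)$ with $\iota_{P,\bar P}\circ\bar\phi=\phi\circ\iota_{Q,\bar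 Q}$. * (III) Let $P_1\le P_2\le\cdots$ be an increasing sequence of members of $\Delta$, and for each $i$ let $\psi_i\in\mathrm{Mor}_{\mathcal T}(P_i,S)$ be such that $\psi_i=\iota_{P_i,P_{i+1}}\circ\psi_{i+1}$ for all $i$. Put $P=\bigcup_iP_i$. Then $P\in\Delta$ and there is $\psi\in\mathrm{Mor}_{\mathcal T}(P,S)$ with $\psi_i=\iota_{P_i,P}\circ\psi$ for all $i$. -/

import Mathlib

universe u

/-! ### Partial groups -/

/-- A partial group: a set `L` with an involutory bijection `g ↦ g⁻¹`, a set `D` of words in the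
alphabet `L`, and a product `D → L`. The product is given as a function on all words; its values
outside `D` carry no meaning and are never used. -/
class PartialGroup (L : Type u) extends Inv L where
  D : Set (List L)
  prod : List L → L
  single_mem : ∀ g : L, [g] ∈ D
  left_mem : ∀ v w : List L, v ++ w ∈ D → v ∈ D
  right_mem : ∀ v w : List L, v ++ w ∈ D → w ∈ D
  prod_single : ∀ g : L, prod [g] = g
  contract_mem : ∀ v w z : List L, v ++ w ++ z ∈ D → v ++ [prod w] ++ z ∈ D
  contract_prod : ∀ v w z : List L, v ++ w ++ z ∈ D → prod (v ++ w ++ z) = prod (v ++ [prod w] ++ z)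
  invol : ∀ g : L, (g⁻¹)⁻¹ = g
  inv_mem : ∀ w : List L, w ∈ D → (w.map (fun g => g⁻¹)).reverse ++ w ∈ D
  inv_prod : ∀ w : List L, w ∈ D → prod ((w.map (fun g => g⁻¹)).reverse ++ w) = prod []

namespace PartialGroup

variable {L : Type u} [PartialGroup L]

/-- The identity element, i.e. the product of the empty word. -/
def unit : L := prod ([] : List L)

/-- `ConjTo g x y` says that `x` lies in the domain `D(g)` of conjugation by `g`, i.e.
`(g⁻¹, x, g) ∈ D`, and that `x ^ g = Π (g⁻¹, x, g)` is equal to `y`. -/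
def ConjTo (g x y : L) : Prop := [g⁻¹, x, g] ∈ (D : Set (List L)) ∧ prod [g⁻¹, x, g] = y

/-- The word `u` is in the domain, and `v` is in the domain with the same product. -/
def Same (v w : List L) : Prop := v ∈ (D : Set (List L)) → w ∈ (D : Set (List L)) ∧ prod v = prod w

theorem nil_mem : ([] : List L) ∈ (D : Set (List L)) :=
  left_mem [] [prod ([] : List L)] (single_mem _)

theorem same_contract (v w z : List L) : Same (v ++ w ++ z) (v ++ [prod w] ++ z) :=
  fun h => ⟨contract_mem v w z h, contract_prod v w z h⟩

theorem Same.trans {v w z : List L} (h : Same v w) (k : Same w z) : Same v z := fun hv =>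
  ⟨(k (h hv).1).1, (h hv).2.trans (k (h hv).1).2⟩

theorem prod_unit_right (a : L) : prod [a, unit] = a := by
  have h := contract_prod [a] [] [] (by simpa using single_mem a)
  simpa [prod_single, unit] using h.symm

theorem prod_unit_left (a : L) : prod [unit, a] = a := by
  have h := contract_prod [] [] [a] (by simpa using single_mem a)
  simpa [prod_single, unit] using h.symm

theorem same_unit (v z : List L) : Same (v ++ [unit] ++ z) (v ++ z) := by
  rcases List.eq_nil_or_concat v with rfl | ⟨v, a, rfl⟩
  · cases z with
    | nil => intro _; exact ⟨nil_mem, by simpa [unit] using prod_single (unit : L)⟩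
    | cons a z =>
      have h := same_contract [] [unit, a] z
      simpa [prod_unit_left] using h
  · have h := same_contract v [a, unit] z
    simpa [prod_unit_right] using h

theorem mul_inv_unit (g : L) : prod [g, g⁻¹] = unit := by
  have h := inv_prod [g⁻¹] (single_mem _)
  simpa [invol, unit] using h

theorem inv_mul_unit (g : L) : prod [g⁻¹, g] = unit := by
  have h := inv_prod [g] (single_mem _)
  simpa [unit] using h

theorem same_cancel (v : List L) (g : L) (z : List L) : Same (v ++ [g, g⁻¹] ++ z) (v ++ z) := by
  have h := same_contract v [g, g⁻¹] z
  rw [mul_inv_unit] at h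
  exact h.trans (same_unit v z)

theorem same_cancel_inv (v : List L) (g : L) (z : List L) : Same (v ++ [g⁻¹, g] ++ z) (v ++ z) := by
  have h := same_contract v [g⁻¹, g] z
  rw [inv_mul_unit] at h
  exact h.trans (same_unit v z)

/-- The formal inverse of a word. -/
def winv (w : List L) : List L := (w.map (fun g => g⁻¹)).reverse

theorem winv_winv (w : List L) : winv (winv w) = w := by
  have : ((fun g : L => g⁻¹) ∘ fun g => g⁻¹) = id := by funext g; exact invol g
  simp [winv, List.map_reverse, List.map_map, this]

theorem winv_mem {w : List L} (h : w ∈ (D : Set (List L))) : winv w ∈ (D : Set (List L)) :=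
  left_mem _ w (inv_mem w h)

theorem winv_append_mem {w : List L} (h : w ∈ (D : Set (List L))) :
    winv w ++ w ∈ (D : Set (List L)) := inv_mem w h

theorem append_winv_mem {w : List L} (h : w ∈ (D : Set (List L))) :
    w ++ winv w ∈ (D : Set (List L)) := by
  have := inv_mem _ (winv_mem h)
  rwa [← winv, winv_winv] at this

theorem eq_inv_of_mul {a g : L} (h : [a, g] ∈ (D : Set (List L))) (e : prod [a, g] = unit) :
    a = g⁻¹ := by
  have h1 : [a, g, g⁻¹, a⁻¹] ∈ (D : Set (List L)) := by
    simpa [winv] using append_winv_mem h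
  have h2 : [a, g, g⁻¹] ∈ (D : Set (List L)) := left_mem [a, g, g⁻¹] [a⁻¹] (by simpa using h1)
  have h3 := (same_cancel [a] g [] (by simpa using h2)).2
  have h4 := (same_contract [] [a, g] [g⁻¹] (by simpa using h2)).2
  rw [e] at h4
  simp only [List.nil_append, List.append_nil, List.cons_append, prod_unit_left, prod_single]
    at h3 h4
  rw [← h3, h4]

theorem prod_winv {w : List L} (h : w ∈ (D : Set (List L))) : prod (winv w) = (prod w)⁻¹ := by
  have h0 := winv_append_mem h
  have h1 := same_contract (winv w) w [] (by simpa using h0)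
  have h2 := same_contract [] (winv w) [prod w] (by simpa using h1.1)
  refine eq_inv_of_mul (by simpa using h2.1) ?_
  have h3 : prod (winv w ++ w) = unit := inv_prod w h
  have h4 := h1.2.trans (by simpa using h2.2)
  simpa using h4.symm.trans (by simpa using h3)

theorem unit_inv : (unit : L)⁻¹ = unit := by
  have := prod_winv (w := ([] : List L)) nil_mem
  simpa [winv, unit] using this.symm

theorem ConjTo.symm {g x y : L} (h : ConjTo g x y) : ConjTo g⁻¹ y x := by
  obtain ⟨h, rfl⟩ := h
  have h1 : [g, g⁻¹, x, g] ∈ (D : Set (List L)) := by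
    refine right_mem [g⁻¹, x⁻¹] _ ?_
    simpa [winv, invol] using winv_append_mem h
  have h2 : [g, g⁻¹, x, g, g⁻¹] ∈ (D : Set (List L)) := by
    refine left_mem _ [x⁻¹, g, g⁻¹] ?_
    simpa [winv, invol] using append_winv_mem h1
  have h3 := same_contract [g] [g⁻¹, x, g] [g⁻¹] (by simpa using h2)
  have h4 := same_cancel [] g [x, g, g⁻¹] (by simpa using h2)
  have h5 := same_cancel [x] g [] (by simpa using h4.1)
  refine ⟨by simpa [invol] using h3.1, ?_⟩
  have e3 := h3.2
  have e4 := h4.2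
  have e5 := h5.2
  simp only [List.nil_append, List.append_nil, List.cons_append, prod_single] at e3 e4 e5
  rw [invol, ← e3, e4, e5]

theorem ConjTo.eq {g x y z : L} (h : ConjTo g x y) (k : ConjTo g x z) : y = z :=
  h.2.symm.trans k.2

theorem ConjTo.inj {g x z y : L} (h : ConjTo g x y) (k : ConjTo g z y) : x = z :=
  h.symm.eq k.symm

theorem conjTo_unit (x : L) : ConjTo (unit : L) x x := by
  have h1 : [unit, x, unit] ∈ (D : Set (List L)) := by
    have h := contract_mem [] [] [x] (by simpa using single_mem x)
    have k := contract_mem [unit, x] [] [] (by simpa [unit] using h)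
    simpa [unit] using k
  have h2 := same_unit [] [x, unit] (by simpa using h1)
  refine ⟨by simpa [unit_inv] using h1, ?_⟩
  have e2 := h2.2
  simp only [List.nil_append, List.cons_append, prod_unit_right] at e2
  rw [unit_inv, e2]

end PartialGroup

open PartialGroup in
/-- A subgroup of the partial group `L`: a subset `H` containing all inverses of its elements, such
that every word in `H` has a product, lying in `H`. -/
@[ext] structure PSubgroup (L : Type u) [PartialGroup L] where
  carrier : Set L
  word_mem : ∀ w : List L, (∀ g ∈ w, g ∈ carrier) → w ∈ (D : Set (List L))
  prod_mem : ∀ w : List L, (∀ g ∈ w, g ∈ carrier) → prod w ∈ carrier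
  inv_mem : ∀ g ∈ carrier, g⁻¹ ∈ carrier

namespace PSubgroup

open PartialGroup

variable {L : Type u} [PartialGroup L]

instance : SetLike (PSubgroup L) L where
  coe H := H.carrier
  coe_injective := by
    intro H K h
    exact PSubgroup.ext h

theorem mul_mem (H : PSubgroup L) {a b : L} (ha : a ∈ H) (hb : b ∈ H) : prod [a, b] ∈ H :=
  H.prod_mem _ (by
    intro g hg
    simp only [List.mem_cons, List.not_mem_nil, or_false] at hg
    rcases hg with rfl | rfl
    · exact ha
    · exact hb)

instance (H : PSubgroup L) : Mul H := ⟨fun a b => ⟨prod [(a : L), b], H.mul_mem a.2 b.2⟩⟩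

instance (H : PSubgroup L) : One H := ⟨⟨unit, H.prod_mem [] (by simp)⟩⟩

instance (H : PSubgroup L) : Inv H := ⟨fun a => ⟨(a : L)⁻¹, H.inv_mem a a.2⟩⟩

theorem coe_mul (H : PSubgroup L) (a b : H) : ((a * b : H) : L) = prod [(a : L), b] := rfl

theorem coe_one (H : PSubgroup L) : ((1 : H) : L) = unit := rfl

theorem coe_inv (H : PSubgroup L) (a : H) : ((a⁻¹ : H) : L) = (a : L)⁻¹ := rfl

theorem word3 (H : PSubgroup L) (a b c : H) : [(a : L), b, c] ∈ (D : Set (List L)) :=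
  H.word_mem _ (by
    intro g hg
    simp only [List.mem_cons, List.not_mem_nil, or_false] at hg
    rcases hg with rfl | rfl | rfl
    · exact a.2
    · exact b.2
    · exact c.2)

theorem mul_left_eq (H : PSubgroup L) (a b c : H) :
    ((a * b * c : H) : L) = prod [(a : L), b, c] := by
  have h := contract_prod [] [(a : L), b] [(c : L)] (by simpa using H.word3 a b c)
  simpa [coe_mul] using h.symm

/-- A subgroup of a partial group is a group, with multiplication `(a, b) ↦ Π (a, b)`. -/
instance (H : PSubgroup L) : Group H :=
  Group.ofLeftAxioms
    (by
      intro a b c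
      apply Subtype.ext
      rw [mul_left_eq]
      have h := contract_prod [(a : L)] [(b : L), c] [] (by simpa using H.word3 a b c)
      simpa [coe_mul] using h)
    (by
      intro a
      apply Subtype.ext
      rw [coe_mul, coe_one]
      exact prod_unit_left _)
    (by
      intro a
      apply Subtype.ext
      rw [coe_mul, coe_inv, coe_one]
      exact inv_mul_unit _)

/-- Inside a subgroup of `L`, conjugation in `L` is conjugation in the group. -/
theorem conjTo_coe (H : PSubgroup L) (s x : H) :
    ConjTo (s : L) (x : L) ((s⁻¹ * x * s : H) : L) :=
  ⟨H.word3 s⁻¹ x s, (H.mul_left_eq s⁻¹ x s).symm⟩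

end PSubgroup

/-! ### Localities -/

section Chains

open PartialGroup

variable {L : Type u} [PartialGroup L] {S : PSubgroup L}

/-- `P ^ g = Q`: conjugation by `g` is defined on `P`, with image `Q`. -/
def ConjEq (P : Subgroup S) (g : L) (Q : Subgroup S) : Prop :=
  (∀ x ∈ P, ∃ y ∈ Q, ConjTo g (x : L) (y : L)) ∧ (∀ y ∈ Q, ∃ x ∈ P, ConjTo g (x : L) (y : L))

/-- `Via Δ (g₁, …, gₙ) P₀` says that there are `P₁, …, Pₙ` such that all of `P₀, …, Pₙ` are in `Δ`
and `Pᵢ₋₁ ^ gᵢ = Pᵢ` for all `i`. -/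
def Via (Δ : Set (Subgroup S)) : List L → Subgroup S → Prop
  | [], P => P ∈ Δ
  | g :: w, P => P ∈ Δ ∧ ∃ Q, ConjEq P g Q ∧ Via Δ w Q

/-- The transporter set `N_L(P, Q)`: all `g` such that `P ≤ S_g` and `P ^ g ≤ Q`. -/
def Transp (P Q : Subgroup S) : Set L :=
  {g | ∀ x ∈ P, ∃ y ∈ Q, ConjTo g (x : L) (y : L)}

/-- `x` lies in `S_w`: it is an element of `S` that is conjugated successively into `S` by the
entries of the word `w`. -/
def InS (S : PSubgroup L) : List L → L → Prop
  | [], x => x ∈ S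
  | g :: w, x => x ∈ S ∧ ∃ y, ConjTo g x y ∧ InS S w y

theorem Via.mem {Δ : Set (Subgroup S)} {w : List L} {P : Subgroup S} (h : Via Δ w P) : P ∈ Δ := by
  cases w with
  | nil => exact h
  | cons g w => exact h.1

theorem ConjEq.symm {P Q : Subgroup S} {g : L} (h : ConjEq P g Q) : ConjEq Q g⁻¹ P := by
  refine ⟨fun y hy => ?_, fun x hx => ?_⟩
  · obtain ⟨x, hx, k⟩ := h.2 y hy
    exact ⟨x, hx, k.symm⟩
  · obtain ⟨y, hy, k⟩ := h.1 x hx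
    exact ⟨y, hy, k.symm⟩

/-- The subgroup `s⁻¹ P s` of `S`. -/
def conjSub (P : Subgroup S) (s : S) : Subgroup S := P.map (MulAut.conj s⁻¹).toMonoidHom

theorem mem_conjSub {P : Subgroup S} {s z : S} : z ∈ conjSub P s ↔ ∃ x ∈ P, s⁻¹ * x * s = z := by
  simp [conjSub, Subgroup.mem_map]

theorem conjEq_conjSub (P : Subgroup S) (s : S) : ConjEq P (s : L) (conjSub P s) := by
  refine ⟨fun x hx => ⟨s⁻¹ * x * s, mem_conjSub.2 ⟨x, hx, rfl⟩, S.conjTo_coe s x⟩, ?_⟩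
  intro y hy
  obtain ⟨x, hx, rfl⟩ := mem_conjSub.1 hy
  exact ⟨x, hx, S.conjTo_coe s x⟩

theorem conjEq_self {P : Subgroup S} {x : S} (hx : x ∈ P) : ConjEq P (x : L) P := by
  refine ⟨fun y hy => ⟨x⁻¹ * y * x, mul_mem (mul_mem (inv_mem hx) hy) hx, S.conjTo_coe x y⟩, ?_⟩
  intro y hy
  refine ⟨x * y * x⁻¹, mul_mem (mul_mem hx hy) (inv_mem hx), ?_⟩
  have h := S.conjTo_coe x (x * y * x⁻¹)
  have e : x⁻¹ * (x * y * x⁻¹) * x = y := by group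
  rwa [e] at h

end Chains

open PartialGroup in
/-- A pre-locality `(L, Δ, S)`: a `p`-subgroup `S` of the partial group `L` and a set `Δ` of subgroups
of `S` with `S ∈ Δ` such that `(L, Δ)` is objective. The latter means that a word is in the domain
of the product if and only if it conjugates some member of `Δ` successively to members of `Δ`, and
that every subgroup of `S` that contains an `L`-conjugate of a member of `Δ` is in `Δ`. -/
structure PreLocality (p : ℕ) (L : Type u) [PartialGroup L] where
  S : PSubgroup L
  isPGroup : IsPGroup p S
  Δ : Set (Subgroup S)
  top_mem : ⊤ ∈ Δ
  mem_D_iff : ∀ w : List L, w ∈ (D : Set (List L)) ↔ ∃ P, Via Δ w P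
  closed : ∀ (X Y : Subgroup S) (g : L), X ∈ Δ → g ∈ Transp X Y → Y ∈ Δ

namespace PreLocality

open PartialGroup

variable {p : ℕ} {L : Type u} [PartialGroup L] (M : PreLocality p L)

theorem conjSub_mem {P : Subgroup M.S} (hP : P ∈ M.Δ) (s : M.S) : conjSub P s ∈ M.Δ :=
  M.closed P _ s hP (conjEq_conjSub P s).1

theorem mem_of_le {P Q : Subgroup M.S} (hP : P ∈ M.Δ) (h : P ≤ Q) : Q ∈ M.Δ :=
  M.closed P Q unit hP (fun x hx => ⟨x, h hx, conjTo_unit _⟩)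

/-- If `a ^ g = b` with `a, b ∈ S`, then `(a⁻¹, g, b)` is in the domain, with product `g`. -/
theorem twist {g : L} {a b : M.S} (h : ConjTo g (a : L) (b : L)) :
    [(a : L)⁻¹, g, (b : L)] ∈ (D : Set (List L)) ∧ prod [(a : L)⁻¹, g, (b : L)] = g := by
  obtain ⟨h, e⟩ := h
  have h1 : [(a : L)⁻¹, g, g⁻¹, (a : L), g] ∈ (D : Set (List L)) := by
    refine right_mem [g⁻¹] _ ?_
    simpa [winv, invol] using winv_append_mem h
  have h2 := same_contract [(a : L)⁻¹, g] [g⁻¹, (a : L), g] [] (by simpa using h1)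
  have h3 := same_cancel [(a : L)⁻¹] g [(a : L), g] (by simpa using h1)
  have h4 := same_cancel_inv [] (a : L) [g] (by simpa using h3.1)
  have e2 := h2.2
  have e3 := h3.2
  have e4 := h4.2
  have m2 := h2.1
  simp only [List.nil_append, List.append_nil, List.cons_append, prod_single, e] at e2 e3 e4 m2
  exact ⟨m2, by rw [← e2, e3, e4]⟩

theorem conjTo_twist {g : L} {X Y : Subgroup M.S} (hX : X ∈ M.Δ) (hY : Y ∈ M.Δ)
    (hXY : ConjEq X g Y) {a b : M.S} (h : ConjTo g (a : L) (b : L)) {x y : M.S} (hx : x ∈ X)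
    (k : ConjTo g (x : L) (y : L)) :
    ConjTo g ((a⁻¹ * x * a : M.S) : L) ((b⁻¹ * y * b : M.S) : L) := by
  have hXa := conjEq_conjSub X a
  have hYb := conjEq_conjSub Y b
  have mXa := M.conjSub_mem hX a
  have mYb := M.conjSub_mem hY b
  have hW : [(b : L)⁻¹, g⁻¹, (a : L), (a : L)⁻¹, (x : L), (a : L), (a : L)⁻¹, g, (b : L)] ∈
      (D : Set (List L)) := by
    rw [M.mem_D_iff]
    exact ⟨conjSub Y b, mYb, _, hYb.symm, hY, _, hXY.symm, hX, _, hXa, mXa, _, hXa.symm, hX, _,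
      conjEq_self hx, hX, _, hXa, mXa, _, hXa.symm, hX, _, hXY, hY, _, hYb, mYb⟩
  obtain ⟨t1, t2⟩ := M.twist h
  have t3 : prod [(b : L)⁻¹, g⁻¹, (a : L)] = g⁻¹ := by
    have := prod_winv t1
    rw [t2] at this
    simpa [winv, invol] using this
  have c1 := same_contract [] [(b : L)⁻¹, g⁻¹, (a : L)]
    [(a : L)⁻¹, (x : L), (a : L), (a : L)⁻¹, g, (b : L)] (by simpa using hW)
  have c2 := same_contract [g⁻¹] [(a : L)⁻¹, (x : L), (a : L)] [(a : L)⁻¹, g, (b : L)]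
    (by simpa [t3] using c1.1)
  have c3 := same_contract [g⁻¹, prod [(a : L)⁻¹, (x : L), (a : L)]] [(a : L)⁻¹, g, (b : L)] []
    (by simpa using c2.1)
  have d1 := same_cancel [(b : L)⁻¹, g⁻¹] (a : L) [(x : L), (a : L), (a : L)⁻¹, g, (b : L)]
    (by simpa using hW)
  have d2 := same_cancel [(b : L)⁻¹, g⁻¹, (x : L)] (a : L) [g, (b : L)] (by simpa using d1.1)
  have d3 := same_contract [(b : L)⁻¹] [g⁻¹, (x : L), g] [(b : L)] (by simpa using d2.1)
  have e1 := c1.2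
  have e2 := c2.2
  have e3 := c3.2
  have f1 := d1.2
  have f2 := d2.2
  have f3 := d3.2
  have m3 := c3.1
  simp only [List.nil_append, List.append_nil, List.cons_append, t2, t3, k.2] at e1 e2 e3 f1 f2 f3 m3
  have ea : ((a⁻¹ * x * a : M.S) : L) = prod [(a : L)⁻¹, (x : L), (a : L)] := M.S.mul_left_eq a⁻¹ x a
  have eb : ((b⁻¹ * y * b : M.S) : L) = prod [(b : L)⁻¹, (y : L), (b : L)] := M.S.mul_left_eq b⁻¹ y b
  rw [ConjTo, ea, eb]
  exact ⟨m3, by rw [← e3, ← e2, ← e1, f1, f2, f3]⟩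

theorem conjEq_twist {g : L} {X Y : Subgroup M.S} (hX : X ∈ M.Δ) (hY : Y ∈ M.Δ)
    (hXY : ConjEq X g Y) {a b : M.S} (h : ConjTo g (a : L) (b : L)) :
    ConjEq (conjSub X a) g (conjSub Y b) := by
  constructor
  · intro z hz
    obtain ⟨x, hx, rfl⟩ := mem_conjSub.1 hz
    obtain ⟨y, hy, k⟩ := hXY.1 x hx
    exact ⟨_, mem_conjSub.2 ⟨y, hy, rfl⟩, M.conjTo_twist hX hY hXY h hx k⟩
  · intro z hz
    obtain ⟨y, hy, rfl⟩ := mem_conjSub.1 hz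
    obtain ⟨x, hx, k⟩ := hXY.2 y hy
    exact ⟨_, mem_conjSub.2 ⟨x, hx, rfl⟩, M.conjTo_twist hX hY hXY h hx k⟩

/-- Conjugation by `g` is multiplicative on `S_g`. -/
theorem conjTo_mul {g : L} {a b c d : M.S} (h : ConjTo g (a : L) (b : L))
    (k : ConjTo g (c : L) (d : L)) : ConjTo g ((a * c : M.S) : L) ((b * d : M.S) : L) := by
  obtain ⟨X, hX, Y, hXY, hY⟩ := (M.mem_D_iff [g]).1 (single_mem g)
  have hY : Y ∈ M.Δ := hY
  have mXa := M.conjSub_mem hX a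
  have mYb := M.conjSub_mem hY b
  have r1 := M.conjEq_twist hX hY hXY h
  have r2 := M.conjEq_twist mXa mYb r1 k
  have mXac := M.conjSub_mem mXa c
  have mYbd := M.conjSub_mem mYb d
  have hW : [g⁻¹, (a : L), g, g⁻¹, (c : L), g] ∈ (D : Set (List L)) := by
    rw [M.mem_D_iff]
    exact ⟨Y, hY, _, hXY.symm, hX, _, conjEq_conjSub X a, mXa, _, r1, mYb, _, r1.symm, mXa, _,
      conjEq_conjSub _ c, mXac, _, r2, mYbd⟩
  have c1 := same_cancel [g⁻¹, (a : L)] g [(c : L), g] (by simpa using hW)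
  have c2 := same_contract [g⁻¹] [(a : L), (c : L)] [g] (by simpa using c1.1)
  have d1 := same_contract [] [g⁻¹, (a : L), g] [g⁻¹, (c : L), g] (by simpa using hW)
  have d2 := same_contract [prod [g⁻¹, (a : L), g]] [g⁻¹, (c : L), g] [] (by simpa using d1.1)
  have e1 := c1.2
  have e2 := c2.2
  have f1 := d1.2
  have f2 := d2.2
  have m2 := c2.1
  simp only [List.nil_append, List.append_nil, List.cons_append, h.2, k.2] at e1 e2 f1 f2 m2
  rw [ConjTo, M.S.coe_mul, M.S.coe_mul]
  exact ⟨m2, by rw [← e2, ← e1, f1, f2]⟩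

theorem conjTo_one (g : L) : ConjTo g ((1 : M.S) : L) ((1 : M.S) : L) := by
  have h : [g⁻¹, g] ∈ (D : Set (List L)) := by simpa [winv] using winv_append_mem (single_mem g)
  have h1 := contract_mem [g⁻¹] [] [g] (by simpa using h)
  have h2 := contract_prod [g⁻¹] [] [g] (by simpa using h)
  rw [M.S.coe_one]
  refine ⟨by simpa [unit] using h1, ?_⟩
  simp only [List.append_nil, List.cons_append, List.nil_append, inv_mul_unit] at h2
  exact h2.symm

/-- For `g ∈ N_L(P, Q)`, the conjugation homomorphism `c_g : P → Q`. -/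
noncomputable def conjHom {P Q : Subgroup M.S} (g : L) (hg : g ∈ Transp P Q) : P →* Q where
  toFun x := ⟨(hg x x.2).choose, (hg x x.2).choose_spec.1⟩
  map_one' := by
    apply Subtype.ext
    apply Subtype.ext
    exact (hg _ (1 : P).2).choose_spec.2.eq (M.conjTo_one g)
  map_mul' x y := by
    apply Subtype.ext
    apply Subtype.ext
    exact (hg _ (x * y).2).choose_spec.2.eq
      (M.conjTo_mul (hg x x.2).choose_spec.2 (hg y y.2).choose_spec.2)

/-- The defining property of `c_g`: it sends `x` to `x ^ g`. -/
theorem conjHom_spec {P Q : Subgroup M.S} (g : L) (hg : g ∈ Transp P Q) (x : P) :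
    ConjTo g ((x : M.S) : L) ((M.conjHom g hg x : M.S) : L) :=
  (hg x x.2).choose_spec.2

theorem conjHom_injective {P Q : Subgroup M.S} (g : L) (hg : g ∈ Transp P Q) :
    Function.Injective (M.conjHom g hg) := by
  intro x y h
  have hx := M.conjHom_spec g hg x
  rw [h] at hx
  exact Subtype.ext (Subtype.ext (hx.inj (M.conjHom_spec g hg y)))

/-- The image `P ^ g`. -/
noncomputable def image {P Q : Subgroup M.S} (g : L) (hg : g ∈ Transp P Q) : Subgroup M.S :=
  (M.conjHom g hg).range.map Q.subtype

theorem image_le {P Q : Subgroup M.S} (g : L) (hg : g ∈ Transp P Q) : M.image g hg ≤ Q := by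
  intro y hy
  obtain ⟨z, -, rfl⟩ := hy
  exact z.2

theorem conjEq_image {P Q : Subgroup M.S} (g : L) (hg : g ∈ Transp P Q) :
    ConjEq P g (M.image g hg) := by
  constructor
  · intro x hx
    exact ⟨_, ⟨M.conjHom g hg ⟨x, hx⟩, ⟨_, rfl⟩, rfl⟩, M.conjHom_spec g hg ⟨x, hx⟩⟩
  · intro y hy
    obtain ⟨z, ⟨x, rfl⟩, rfl⟩ := hy
    exact ⟨x, x.2, M.conjHom_spec g hg x⟩

theorem image_mem {P Q : Subgroup M.S} (hP : P ∈ M.Δ) (g : L) (hg : g ∈ Transp P Q) :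
    M.image g hg ∈ M.Δ :=
  M.closed P _ g hP (M.conjEq_image g hg).1

theorem mul_mem_D {P Q R : Subgroup M.S} (hP : P ∈ M.Δ) {g h : L} (hg : g ∈ Transp P Q)
    (hh : h ∈ Transp Q R) : [g, h] ∈ (D : Set (List L)) := by
  rw [M.mem_D_iff]
  have hh2 : h ∈ Transp (M.image g hg) R := fun x hx => hh x (M.image_le g hg hx)
  have h1 := M.image_mem hP g hg
  exact ⟨P, hP, _, M.conjEq_image g hg, h1, _, M.conjEq_image h hh2, M.image_mem h1 h hh2⟩

theorem mul3_mem_D {P Q R T : Subgroup M.S} (hP : P ∈ M.Δ) {g h k : L} (hg : g ∈ Transp P Q)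
    (hh : h ∈ Transp Q R) (hk : k ∈ Transp R T) : [g, h, k] ∈ (D : Set (List L)) := by
  rw [M.mem_D_iff]
  have hh2 : h ∈ Transp (M.image g hg) R := fun x hx => hh x (M.image_le g hg hx)
  have h1 := M.image_mem hP g hg
  have h2 := M.image_mem h1 h hh2
  have hk2 : k ∈ Transp (M.image h hh2) T := fun x hx => hk x (M.image_le h hh2 hx)
  exact ⟨P, hP, _, M.conjEq_image g hg, h1, _, M.conjEq_image h hh2, h2, _,
    M.conjEq_image k hk2, M.image_mem h2 k hk2⟩

/-- `x ^ (g h) = (x ^ g) ^ h` for `x ∈ P ∈ Δ`. -/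
theorem conjTo_comp {P Q R : Subgroup M.S} (hP : P ∈ M.Δ) {g h : L} (hg : g ∈ Transp P Q)
    (hh : h ∈ Transp Q R) {x : M.S} (hx : x ∈ P) {y z : L} (k : ConjTo g (x : L) y)
    (l : ConjTo h y z) : ConjTo (prod [g, h]) (x : L) z := by
  have hh2 : h ∈ Transp (M.image g hg) R := fun x hx => hh x (M.image_le g hg hx)
  have h1 := M.image_mem hP g hg
  have h2 := M.image_mem h1 h hh2
  have r1 := M.conjEq_image g hg
  have r2 := M.conjEq_image h hh2
  have hW : [h⁻¹, g⁻¹, (x : L), g, h] ∈ (D : Set (List L)) := by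
    rw [M.mem_D_iff]
    exact ⟨_, h2, _, r2.symm, h1, _, r1.symm, hP, _, conjEq_self hx, hP, _, r1, h1, _, r2, h2⟩
  have t : prod [h⁻¹, g⁻¹] = (prod [g, h])⁻¹ := by
    have := prod_winv (M.mul_mem_D hP hg hh)
    simpa [winv] using this
  have c1 := same_contract [] [h⁻¹, g⁻¹] [(x : L), g, h] (by simpa using hW)
  have c2 := same_contract [prod [h⁻¹, g⁻¹], (x : L)] [g, h] [] (by simpa using c1.1)
  have d1 := same_contract [h⁻¹] [g⁻¹, (x : L), g] [h] (by simpa using hW)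
  have e1 := c1.2
  have e2 := c2.2
  have f1 := d1.2
  have m2 := c2.1
  simp only [List.nil_append, List.append_nil, List.cons_append, t, k.2, l.2] at e1 e2 f1 m2
  exact ⟨m2, by rw [← e2, ← e1, f1]⟩

theorem trans_mul {P Q R : Subgroup M.S} (hP : P ∈ M.Δ) {g h : L} (hg : g ∈ Transp P Q)
    (hh : h ∈ Transp Q R) : prod [g, h] ∈ (Transp P R : Set L) := by
  intro x hx
  obtain ⟨y, hy, k⟩ := hg x hx
  obtain ⟨z, hz, l⟩ := hh y hy
  exact ⟨z, hz, M.conjTo_comp hP hg hh hx k l⟩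

theorem unit_mem_trans {P Q : Subgroup M.S} (h : P ≤ Q) : unit ∈ (Transp P Q : Set L) :=
  fun x hx => ⟨x, h hx, conjTo_unit _⟩

/-- For `P ∈ Δ`, the normalizer `N_L(P) = {g ∈ L | P ^ g = P}`, which is a subgroup of `L`. -/
def normalizer (P : Subgroup M.S) (hP : P ∈ M.Δ) : PSubgroup L where
  carrier := {g | ConjEq P g P}
  word_mem w hw := by
    rw [M.mem_D_iff]
    refine ⟨P, ?_⟩
    induction w with
    | nil => exact hP
    | cons g w ih =>
      exact ⟨hP, P, hw g (by simp), ih (fun k hk => hw k (by simp [hk]))⟩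
  prod_mem w hw := by
    have key : w ∈ (D : Set (List L)) ∧ ConjEq P (prod w) P := by
      induction w with
      | nil =>
        exact ⟨nil_mem, fun x hx => ⟨x, hx, conjTo_unit _⟩, fun x hx => ⟨x, hx, conjTo_unit _⟩⟩
      | cons g w ih =>
        have hg : ConjEq P g P := hw g (by simp)
        obtain ⟨-, h⟩ := ih (fun k hk => hw k (by simp [hk]))
        have hD : g :: w ∈ (D : Set (List L)) := by
          rw [M.mem_D_iff]
          refine ⟨P, ?_⟩
          have hw2 : ∀ k ∈ w, ConjEq P k P := fun k hk => hw k (by simp [hk])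
          clear hw ih h
          refine ⟨hP, P, hg, ?_⟩
          induction w with
          | nil => exact hP
          | cons k w ih => exact ⟨hP, P, hw2 k (by simp), ih (fun l hl => hw2 l (by simp [hl]))⟩
        have e := contract_prod [g] w [] (by simpa using hD)
        simp only [List.append_nil, List.cons_append, List.nil_append] at e
        refine ⟨hD, ?_⟩
        rw [e]
        refine ⟨M.trans_mul hP hg.1 h.1, fun z hz => ?_⟩
        obtain ⟨y, hy, l⟩ := h.2 z hz
        obtain ⟨x, hx, k⟩ := hg.2 y hy
        exact ⟨x, hx, M.conjTo_comp hP hg.1 h.1 hx k l⟩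
    exact key.2
  inv_mem g hg := ConjEq.symm hg

/-- The centralizer `C_L(P) = {g ∈ L | x ^ g = x for all x ∈ P}`. -/
def centralizer (P : Subgroup M.S) : Set L := {g | ∀ x ∈ P, ConjTo g (x : L) (x : L)}

end PreLocality

/-! ### Groups -/

/-- The Prüfer group `ℤ(p^∞)`: the `p`-power torsion of `ℚ / ℤ`. -/
def pruferSubgroup (p : ℕ) : AddSubgroup (AddCircle (1 : ℚ)) where
  carrier := {x | ∃ n : ℕ, (p ^ n) • x = 0}
  zero_mem' := ⟨0, by simp⟩
  add_mem' := by
    rintro x y ⟨m, hm⟩ ⟨n, hn⟩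
    refine ⟨m + n, ?_⟩
    rw [smul_add, pow_add, mul_smul, mul_smul, hn, smul_zero, smul_comm, hm, smul_zero, add_zero]
  neg_mem' := by
    rintro x ⟨m, hm⟩
    exact ⟨m, by rw [smul_neg, hm, neg_zero]⟩

/-- A `p`-torus: a direct product of finitely many copies of the Prüfer group. -/
def IsTorus (p : ℕ) (T : Type*) [Group T] : Prop :=
  ∃ k : ℕ, Nonempty (T ≃* (Fin k → Multiplicative (pruferSubgroup p)))

/-- `G` is virtually `p`-toral: some subgroup of finite index is a `p`-torus. -/
def IsVirtuallyToral (p : ℕ) (G : Type*) [Group G] : Prop :=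
  ∃ T : Subgroup G, T.FiniteIndex ∧ IsTorus p T

/-- `O_p(G)`: the subgroup generated by (equivalently, the largest of) the normal `p`-subgroups. -/
def pRadical (p : ℕ) (G : Type*) [Group G] : Subgroup G :=
  sSup {N : Subgroup G | N.Normal ∧ IsPGroup p N}

/-- `G` is of characteristic `p`: `C_G(O_p(G)) ≤ O_p(G)`. -/
def IsOfCharacteristic (p : ℕ) (G : Type*) [Group G] : Prop :=
  Subgroup.centralizer (pRadical p G : Set G) ≤ pRadical p G

/-- The normalizer-increasing property: `X < N_Y(X)` whenever `X < Y` are subgroups. -/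
def IsNormalizerIncreasing (S : Type*) [Group S] : Prop :=
  ∀ X Y : Subgroup S, X < Y → ∃ y ∈ Y, y ∉ X ∧ ∀ x : S, x ∈ X ↔ y⁻¹ * x * y ∈ X

/-- The transporter set `N_S(P, Q) = {s ∈ S | P ^ s ≤ Q}` in a group `S`. -/
def GTransp {S : Type*} [Group S] (P Q : Subgroup S) : Set S := {s | ∀ x ∈ P, s⁻¹ * x * s ∈ Q}

/-! ### Fusion systems -/

/-- A fusion system on the group `S`: for all `P, Q ≤ S` a set of injective homomorphisms `P → Q`,
containing all conjugation maps by elements of `S` (hence all inclusions), closed under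
composition, and such that every morphism is an isomorphism of the system (one whose inverse is a
morphism as well) followed by an inclusion. -/
structure FusionSystem (S : Type u) [Group S] where
  IsHom : ∀ {P Q : Subgroup S}, (P →* Q) → Prop
  injective : ∀ {P Q : Subgroup S} (φ : P →* Q), IsHom φ → Function.Injective φ
  conj : ∀ {P Q : Subgroup S} (s : S) (φ : P →* Q),
    (∀ x : P, (φ x : S) = s⁻¹ * x * s) → IsHom φ
  comp : ∀ {P Q R : Subgroup S} (φ : P →* Q) (ψ : Q →* R), IsHom φ → IsHom ψ → IsHom (ψ.comp φ)
  codRestrict : ∀ {P Q R : Subgroup S} (φ : P →* Q) (ψ : P →* R), IsHom φ →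
    (∀ x : P, (ψ x : S) = φ x) → IsHom ψ
  symm : ∀ {P Q : Subgroup S} (e : P ≃* Q), IsHom e.toMonoidHom → IsHom e.symm.toMonoidHom

namespace FusionSystem

open CategoryTheory

section Generate

variable {S : Type u} [Group S]

/-- The morphisms of the fusion system generated by a set `X` of homomorphisms. -/
inductive Generated (X : ∀ P Q : Subgroup S, (P →* Q) → Prop) :
    ∀ P Q : Subgroup S, (P →* Q) → Prop
  | of {P Q : Subgroup S} (φ : P →* Q) (h : X P Q φ) : Generated X P Q φ
  | conj {P Q : Subgroup S} (s : S) (φ : P →* Q) (h : ∀ x : P, (φ x : S) = s⁻¹ * x * s) :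
      Generated X P Q φ
  | comp {P Q R : Subgroup S} (φ : P →* Q) (ψ : Q →* R) (h : Generated X P Q φ)
      (k : Generated X Q R ψ) : Generated X P R (ψ.comp φ)
  | codRestrict {P Q R : Subgroup S} (φ : P →* Q) (ψ : P →* R) (h : Generated X P Q φ)
      (e : ∀ x : P, (ψ x : S) = φ x) : Generated X P R ψ
  | symm {P Q : Subgroup S} (e : P ≃* Q) (h : Generated X P Q e.toMonoidHom) :
      Generated X Q P e.symm.toMonoidHom

/-- The fusion system generated by a set `X` of injective homomorphisms, i.e. the smallest fusion
system on `S` that contains `X`. -/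
def generate (X : ∀ P Q : Subgroup S, (P →* Q) → Prop)
    (hX : ∀ (P Q : Subgroup S) (φ : P →* Q), X P Q φ → Function.Injective φ) :
    FusionSystem S where
  IsHom {P Q} φ := Generated X P Q φ
  injective := by
    intro P Q φ h
    induction h with
    | of φ h => exact hX _ _ φ h
    | conj s φ h =>
      intro x y e
      have : (φ x : S) = φ y := by rw [e]
      rw [h, h] at this
      exact Subtype.ext (mul_left_cancel (mul_right_cancel this))
    | comp φ ψ _ _ ih ik => exact ik.comp ih
    | codRestrict φ ψ _ e ih =>
      intro x y k
      apply ih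
      apply Subtype.ext
      rw [← e, ← e, k]
    | symm e _ _ => exact e.symm.injective
  conj := Generated.conj
  comp := Generated.comp
  codRestrict := Generated.codRestrict
  symm := Generated.symm

end Generate

variable {S : Type u} [Group S] (F : FusionSystem S)

theorem id_isHom (P : Subgroup S) : F.IsHom (MonoidHom.id P) :=
  F.conj 1 _ (by intro x; simp)

/-- `Q` is an `F`-conjugate of `P`. -/
def IsConj (P Q : Subgroup S) : Prop := ∃ e : P ≃* Q, F.IsHom e.toMonoidHom

/-- `P` is `F`-centric: `C_S(Q) ≤ Q` for every `F`-conjugate `Q` of `P`. -/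
def IsCentric (P : Subgroup S) : Prop :=
  ∀ Q : Subgroup S, F.IsConj P Q → Subgroup.centralizer (Q : Set S) ≤ Q

/-- The group `Aut_F(P)`. -/
def aut (P : Subgroup S) : Subgroup (MulAut P) where
  carrier := {α | F.IsHom (α : P ≃* P).toMonoidHom}
  one_mem' := F.id_isHom P
  mul_mem' hα hβ := F.comp _ _ hβ hα
  inv_mem' hα := F.symm _ hα

/-- The group `Out_F(P) = Aut_F(P) / Inn(P)`. -/
abbrev Out (P : Subgroup S) : Type u :=
  F.aut P ⧸ ((MulAut.conj : P →* MulAut P).range.subgroupOf (F.aut P))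

instance (P : Subgroup S) : ((MulAut.conj : P →* MulAut P).range.subgroupOf (F.aut P)).Normal := by
  have : ((MulAut.conj : P →* MulAut P).range).Normal := by
    constructor
    rintro _ ⟨x, rfl⟩ α
    refine ⟨α x, ?_⟩
    ext y
    simp [MulAut.conj_apply]
  infer_instance

/-- `P` is `F`-radical: `O_p(Out_F(P)) = 1`. -/
def IsRadical (p : ℕ) (P : Subgroup S) : Prop := pRadical p (F.Out P) = ⊥

/-- An object of the fusion system regarded as a category: a subgroup of `S`. -/
structure Obj (F : FusionSystem S) where
  grp : Subgroup S

/-- The fusion system as a category. -/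
instance : Category F.Obj where
  Hom P Q := {φ : P.grp →* Q.grp // F.IsHom φ}
  id P := ⟨MonoidHom.id _, F.id_isHom _⟩
  comp φ ψ := ⟨ψ.1.comp φ.1, F.comp _ _ φ.2 ψ.2⟩

end FusionSystem

namespace PreLocality

variable {p : ℕ} {L : Type u} [PartialGroup L] (M : PreLocality p L)

/-- The fusion system `F_S(L)` on `S` generated by the conjugation maps `c_g : P → Q` for
`P, Q ∈ Δ` and `g ∈ N_L(P, Q)`. -/
noncomputable def fusion : FusionSystem M.S :=
  FusionSystem.generate
    (fun P Q φ => P ∈ M.Δ ∧ Q ∈ M.Δ ∧ ∃ (g : L) (hg : g ∈ Transp P Q), φ = M.conjHom g hg)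
    (by
      rintro P Q φ ⟨-, -, g, hg, rfl⟩
      exact M.conjHom_injective g hg)

/-- The poset `Ω_S(L)`, ordered by inclusion: all intersections of nonempty families of the sets
`S_w`, for words `w` in `L`. -/
def Omega : Set (Set L) :=
  {A | ∃ W : Set (List L), W.Nonempty ∧ A = {x | ∀ w ∈ W, InS M.S w x}}

end PreLocality

/-- A (discrete) locality `(L, Δ, S)`: a pre-locality in which `S` is a maximal `p`-subgroup of `L`
and the poset `Ω_S(L)` is finite-dimensional, i.e. there is a bound on the lengths of its strictly
increasing chains. -/
structure Locality (p : ℕ) (L : Type u) [PartialGroup L] extends PreLocality p L where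
  maximal : ∀ H : PSubgroup L, (∀ x ∈ S, x ∈ H) → IsPGroup p H → H = S
  finiteDim : ∃ n : ℕ, ∀ s : LTSeries toPreLocality.Omega, s.length ≤ n

namespace Locality

variable {p : ℕ} {L : Type u} [PartialGroup L]

/-- A proper locality: all centric radical subgroups are objects, the normalizers `N_L(P)` of
objects are of characteristic `p`, and `S` has the normalizer-increasing property. -/
structure IsProper (M : Locality p L) : Prop where
  centric_radical : ∀ P : Subgroup M.S, M.fusion.IsCentric P → M.fusion.IsRadical p P → P ∈ M.Δ
  characteristic : ∀ (P : Subgroup M.S) (hP : P ∈ M.Δ), IsOfCharacteristic p (M.normalizer P hP)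
  normalizerIncreasing : IsNormalizerIncreasing M.S

/-- A compact locality: a proper locality in which the normalizers `N_L(P)` of objects are virtually
`p`-toral. -/
structure IsCompact (M : Locality p L) : Prop where
  proper : M.IsProper
  toral : ∀ (P : Subgroup M.S) (hP : P ∈ M.Δ), IsVirtuallyToral p (M.normalizer P hP)

end Locality

/-! ### Transporter categories -/

namespace PreLocality

open CategoryTheory PartialGroup

variable {p : ℕ} {L : Type u} [PartialGroup L] (M : PreLocality p L)

/-- An object of the transporter category `T_Δ(S)`: a member of `Δ`. -/
structure TS (M : PreLocality p L) where
  grp : Subgroup M.S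
  mem : grp ∈ M.Δ

/-- An object of the transporter category `T = T_Δ(L)`: a member of `Δ`. -/
structure TL (M : PreLocality p L) where
  grp : Subgroup M.S
  mem : grp ∈ M.Δ

variable {M}

/-- The category `T_Δ(S)`: the morphisms `P → Q` are the elements of `N_S(P, Q)`. -/
instance : Category M.TS where
  Hom P Q := {s : M.S // s ∈ GTransp P.grp Q.grp}
  id P := ⟨1, fun x hx => by simpa using hx⟩
  comp s t := ⟨s.1 * t.1, fun x hx => by
    have h := t.2 _ (s.2 x hx)
    simpa [mul_assoc] using h⟩
  id_comp s := Subtype.ext (one_mul _)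
  comp_id s := Subtype.ext (mul_one _)
  assoc s t r := Subtype.ext (mul_assoc _ _ _)

/-- The category `T = T_Δ(L)`: the morphisms `P → Q` are the elements of `N_L(P, Q)`, and the
composite of `g : P → Q` followed by `h : Q → R` is `g h = Π (g, h)`. -/
instance : Category M.TL where
  Hom P Q := {g : L // g ∈ Transp P.grp Q.grp}
  id P := ⟨unit, M.unit_mem_trans le_rfl⟩
  comp {P _ _} g h := ⟨prod [g.1, h.1], M.trans_mul P.mem g.2 h.2⟩
  id_comp g := Subtype.ext (prod_unit_left _)
  comp_id g := Subtype.ext (prod_unit_right _)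
  assoc {P _ _ _} g h k := by
    apply Subtype.ext
    have w := M.mul3_mem_D P.mem g.2 h.2 k.2
    have e1 := contract_prod [] [g.1, h.1] [k.1] (by simpa using w)
    have e2 := contract_prod [g.1] [h.1, k.1] [] (by simpa using w)
    simp only [List.nil_append, List.append_nil, List.cons_append] at e1 e2
    exact e1.symm.trans e2

variable (M)

/-- The functor `ε : T_Δ(S) → T`: the identity on objects, and the inclusion
`N_S(P, Q) → N_L(P, Q)` on morphisms. -/
def eps : M.TS ⥤ M.TL where
  obj P := ⟨P.grp, P.mem⟩
  map s := ⟨(s.1 : L), fun x hx => ⟨_, s.2 x hx, M.S.conjTo_coe s.1 x⟩⟩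
  map_id _ := rfl
  map_comp _ _ := rfl

/-- The functor `ρ : T → F`: the inclusion on objects, and `g ↦ c_g` on morphisms. -/
noncomputable def rho : M.TL ⥤ M.fusion.Obj where
  obj P := ⟨P.grp⟩
  map {P Q} g := ⟨M.conjHom g.1 g.2, FusionSystem.Generated.of _ ⟨P.mem, Q.mem, g.1, g.2, rfl⟩⟩
  map_id P := by
    apply Subtype.ext
    ext x
    exact (M.conjHom_spec unit (M.unit_mem_trans le_rfl) x).eq (conjTo_unit ((x : M.S) : L))
  map_comp {P Q R} g h := by
    apply Subtype.ext
    ext x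
    exact (M.conjHom_spec (prod [g.1, h.1]) (M.trans_mul P.mem g.2 h.2) x).eq
      (M.conjTo_comp P.mem g.2 h.2 x.2 (M.conjHom_spec g.1 g.2 x) (M.conjHom_spec h.1 h.2 _))

variable {M}

/-- The map `ε_{P,Q} : N_S(P, Q) → Mor_T(P, Q)`. -/
def epsHom (P Q : M.TL) (s : GTransp P.grp Q.grp) : P ⟶ Q :=
  M.eps.map (X := ⟨P.grp, P.mem⟩) (Y := ⟨Q.grp, Q.mem⟩) s

/-- The map `ρ_{P,Q} : Mor_T(P, Q) → Hom_F(P, Q)`, with values regarded as homomorphisms. -/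
noncomputable def rhoHom {P Q : M.TL} (φ : P ⟶ Q) : P.grp →* Q.grp := (M.rho.map φ).1

/-- The `T`-automorphism `(x) ε_P` of `P` for `x ∈ P`, as a morphism. -/
def epsElt (P : M.TL) (x : P.grp) : P ⟶ P :=
  epsHom P P ⟨x, fun _ hy => mul_mem (mul_mem (inv_mem x.2) hy) x.2⟩

/-- The inclusion morphism `ι_{P,Q} = (1) ε_{P,Q}` for `P ≤ Q`. -/
def iota (P Q : M.TL) (h : P.grp ≤ Q.grp) : P ⟶ Q :=
  epsHom P Q ⟨1, fun x hx => by simpa using h hx⟩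

/-- `Ker(ρ_P)`, where `ρ_P : Aut_T(P) → Aut_F(P)`. -/
noncomputable def kerRho (P : M.TL) : Subgroup (Aut P) := (M.rho.mapAut P).ker

/-- The image of `N_S(P)`, the automorphism group of `P` in `T_Δ(S)`, under
`ε_P : N_S(P) → Aut_T(P)`. -/
def epsImage (P : M.TL) : Subgroup (Aut P) := (M.eps.mapAut (X := (⟨P.grp, P.mem⟩ : M.TS))).range

/-- The object `S` of `T`. -/
def topObj (M : PreLocality p L) : M.TL := ⟨⊤, M.top_mem⟩

end PreLocality

/-! ### Virtually toral groups -/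

section VirtuallyToral

variable {p : ℕ}

/-! Most of the proposition is calculation with words: every morphism of the transporter category is
an element `g` of `L`, and inserting or cancelling `g` and its inverse in words conjugating an
object gives the commutation rule (C) and cancellation on both sides (`mono_of_hom`, `epi_of_hom`),
whence freeness in (A2). Two elements inducing the same map on `P` differ by an element centralizing
`P` (`rhoHom_eq_iff`). Surjectivity of `ρ` holds because the generation rules of the fusion system
never leave the conjugation maps once an object is involved (`exists_conjTo_of_generated`). In (II)
and (III) the extension is the same element of `L`; only its transporter set has to be enlarged.

The substance is (I): some conjugate `Q` of a given object has `N_S(Q)` as a Sylow subgroup of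
`N_L(Q)`. Two ingredients replace finiteness. First, in a virtually `p`-toral group the normalizers
of `p`-subgroups grow and there are finitely many Sylow subgroups, so these are conjugate and of
index prime to `p`. Second, each `P ≤ S` has a closure `star P`, the intersection of all `S_w`
containing it. Closure commutes with conjugation, and the height of the closure in `Ω` is a bounded,
conjugation invariant dimension that grows strictly with the closure.

By descending induction on this dimension, `Locality.absorbs` shows that every `p`-subgroup of
`N_L(Q)` can be conjugated into `S` by an element that also conjugates `Q` into `S`. One may take
`Q` closed, with `N_S(Q)` of maximal dimension among its conjugates. If `Q = S`, maximality of `S`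
applies. Otherwise `N_S(Q)` has larger dimension than `Q`, so it absorbs, and
`exists_sylow_eq_trace` makes it a Sylow subgroup; Sylow conjugacy completes the induction. Applied
to a Sylow subgroup of `N_L(R)`, absorption yields (I).

That endomorphisms are automorphisms follows from the same dimension: if `P` is conjugated into
itself by `g`, then `g` normalizes `star P`, and it has finite order there. -/

theorem finite_pruferSubgroup_torsion [Fact p.Prime] (n : ℕ) :
    {x : pruferSubgroup p | (p ^ n) • x = 0}.Finite := by
  have h := AddCircle.finite_torsion (1 : ℚ) (pow_pos (Fact.out : p.Prime).pos n)
  refine (h.preimage (f := ((↑) : pruferSubgroup p → AddCircle (1 : ℚ)))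
    Subtype.val_injective.injOn).subset ?_
  intro x hx
  have hx : (p ^ n) • x = 0 := hx
  exact congrArg Subtype.val hx

theorem isPGroup_prufer : IsPGroup p (Multiplicative (pruferSubgroup p)) := by
  rintro ⟨x, n, hn⟩
  exact ⟨n, congrArg Multiplicative.ofAdd (Subtype.ext hn)⟩

namespace IsTorus

variable {T : Type*} [Group T]

theorem isPGroup (hT : IsTorus p T) : IsPGroup p T := by
  obtain ⟨k, ⟨e⟩⟩ := hT
  refine IsPGroup.of_injective ?_ e.toMonoidHom e.injective
  intro f
  choose n hn using fun i => isPGroup_prufer (p := p) (f i)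
  refine ⟨∑ i, n i, funext fun i => ?_⟩
  obtain ⟨c, hc⟩ := pow_dvd_pow p
    (Finset.single_le_sum (f := n) (fun _ _ => Nat.zero_le _) (Finset.mem_univ i))
  rw [Pi.pow_apply, hc, pow_mul, hn, one_pow, Pi.one_apply]

theorem finite_torsion [Fact p.Prime] (hT : IsTorus p T) (n : ℕ) :
    {t : T | t ^ p ^ n = 1}.Finite := by
  obtain ⟨k, ⟨e⟩⟩ := hT
  have h1 : {x : Multiplicative (pruferSubgroup p) | x ^ p ^ n = 1}.Finite :=
    finite_pruferSubgroup_torsion n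
  have h2 := Set.Finite.pi' (fun _ : Fin k => h1)
  refine (h2.preimage (f := e) e.injective.injOn).subset ?_
  intro t ht i
  have ht : t ^ p ^ n = 1 := ht
  have := congrFun (congrArg e ht) i
  simpa using this

theorem mul_comm (hT : IsTorus p T) (a b : T) : a * b = b * a := by
  obtain ⟨k, ⟨e⟩⟩ := hT
  apply e.injective
  rw [map_mul, map_mul, _root_.mul_comm]

end IsTorus

variable {G : Type*} [Group G]

/-- A virtually `p`-toral group has a normal abelian `p`-subgroup of finite index whose
`p ^ n`-torsion is finite for all `n`. -/
theorem IsVirtuallyToral.exists_normal [Fact p.Prime] (hG : IsVirtuallyToral p G) :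
    ∃ T : Subgroup G, T.Normal ∧ T.FiniteIndex ∧ IsPGroup p T ∧
      (∀ a ∈ T, ∀ b ∈ T, a * b = b * a) ∧ ∀ n : ℕ, {t : G | t ∈ T ∧ t ^ p ^ n = 1}.Finite := by
  obtain ⟨T, hfin, hT⟩ := hG
  have hle := T.normalCore_le
  -- All recorded properties of the torus other than finite index pass to subgroups, so the core
  -- need not be identified further.
  refine ⟨T.normalCore, inferInstance, inferInstance, hT.isPGroup.to_le hle, ?_, fun n => ?_⟩
  · intro a ha b hb
    exact congrArg Subtype.val (hT.mul_comm ⟨a, hle ha⟩ ⟨b, hle hb⟩)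
  · refine ((hT.finite_torsion n).image Subtype.val).subset ?_
    rintro t ⟨ht, h⟩
    exact ⟨⟨t, hle ht⟩, Subtype.ext h, rfl⟩

theorem IsVirtuallyToral.isTorsion [Fact p.Prime] (hG : IsVirtuallyToral p G) (g : G) :
    ∃ n, 0 < n ∧ g ^ n = 1 := by
  obtain ⟨T, _, _, hp, -, -⟩ := hG.exists_normal
  obtain ⟨k, hk⟩ := hp ⟨g ^ T.index, T.pow_index_mem g⟩
  refine ⟨T.index * p ^ k, Nat.mul_pos (Nat.pos_of_ne_zero Subgroup.FiniteIndex.index_ne_zero)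
    (pow_pos (Fact.out : p.Prime).pos k), ?_⟩
  rw [pow_mul]
  exact congrArg Subtype.val hk

/-! ### Sylow subgroups and normalizer growth in virtually toral groups. -/

theorem Sylow.le_of_normal {T : Subgroup G} [T.Normal] (hT : IsPGroup p T) (P : Sylow p G) :
    T ≤ P := by
  have h := P.is_maximal' (P.isPGroup'.to_sup_of_normal_right hT) le_sup_left
  exact h ▸ le_sup_right

/-- Every Sylow subgroup contains the normal `p`-subgroup `T` of finite index, so it is determined
by its image in the finite set `G ⧸ T`. Finiteness is what makes Sylow conjugacy available. -/
theorem IsVirtuallyToral.finite_sylow [Fact p.Prime] (hG : IsVirtuallyToral p G) :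
    Finite (Sylow p G) := by
  obtain ⟨T, _, _, hp, -, -⟩ := hG.exists_normal
  refine Finite.of_injective (β := Set (G ⧸ T))
    (fun P => (QuotientGroup.mk : G → G ⧸ T) '' (P : Set G)) ?_
  have key : ∀ P Q : Sylow p G, (QuotientGroup.mk : G → G ⧸ T) '' (P : Set G) =
      (QuotientGroup.mk : G → G ⧸ T) '' (Q : Set G) → ∀ x ∈ P, x ∈ Q := by
    intro P Q h x hx
    have : (QuotientGroup.mk x : G ⧸ T) ∈ (QuotientGroup.mk : G → G ⧸ T) '' (Q : Set G) :=
      h ▸ ⟨x, hx, rfl⟩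
    obtain ⟨y, hy, e⟩ := this
    have hT : y⁻¹ * x ∈ Q := Sylow.le_of_normal hp Q (QuotientGroup.eq.1 e)
    have := mul_mem hy hT
    rwa [mul_inv_cancel_left] at this
  intro P Q h
  exact SetLike.ext fun x => ⟨key P Q h x, key Q P h.symm x⟩

theorem IsVirtuallyToral.finiteIndex_sylow [Fact p.Prime] (hG : IsVirtuallyToral p G)
    (P : Sylow p G) : (P : Subgroup G).FiniteIndex := by
  obtain ⟨T, _, _, hp, -, -⟩ := hG.exists_normal
  exact Subgroup.finiteIndex_of_le (Sylow.le_of_normal hp P)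

/-- The inverse of `y` is a nonnegative power of `y`, so one inclusion between `X` and its conjugate
forces the other even when `X` is infinite. -/
theorem Subgroup.mem_normalizer_of_pow_eq_one {X : Subgroup G} {y : G} {n : ℕ} (hn : 0 < n)
    (hy : y ^ n = 1) (h : ∀ x ∈ X, y⁻¹ * x * y ∈ X) : y ∈ Subgroup.normalizer (X : Set G) := by
  have hpow : ∀ n : ℕ, ∀ x ∈ X, (y ^ n)⁻¹ * x * y ^ n ∈ X := by
    intro n
    induction n with
    | zero => intro x hx; simpa using hx
    | succ n ih =>
      intro x hx
      have := h _ (ih x hx)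
      rw [pow_succ]
      simpa [mul_assoc] using this
  rw [Subgroup.mem_normalizer_iff'']
  refine fun x => ⟨h x, fun hx => ?_⟩
  have := hpow (n - 1) _ hx
  have e : y ^ (n - 1) = y⁻¹ := by
    rw [eq_inv_iff_mul_eq_one, ← pow_succ, Nat.sub_add_cancel hn, hy]
  rw [e] at this
  simpa [mul_assoc] using this

/-- If a `p`-group `W ≤ Y` has finitely many but more than one translates in `G ⧸ X`, and is
normalized by `X ≤ Y`, then it contains a nontrivial element of `N_Y(X) / X`. -/
theorem Subgroup.exists_mem_normalizer [Fact p.Prime] {X Y W : Subgroup G} (hY : IsPGroup p Y)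
    (hXY : X ≤ Y) (hWY : W ≤ Y) (hWX : ¬ W ≤ X) (hXW : ∀ x ∈ X, ∀ w ∈ W, x * w * x⁻¹ ∈ W)
    (hfin : (MulAction.orbit W ((1 : G) : G ⧸ X)).Finite) :
    ∃ y ∈ Y, y ∉ X ∧ y ∈ Subgroup.normalizer (X : Set G) := by
  -- The `W`-orbit of the trivial coset is stable under `X`: for `x ∈ X` the coset `x w X` equals
  -- `(x w x⁻¹) X`, and `X` normalizes `W`.
  let A : SubMulAction X (G ⧸ X) :=
    { carrier := MulAction.orbit W ((1 : G) : G ⧸ X)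
      smul_mem' := by
        rintro x _ ⟨w, rfl⟩
        refine ⟨⟨x * w * x⁻¹, hXW x x.2 w w.2⟩, ?_⟩
        change ((x * w * x⁻¹ * 1 : G) : G ⧸ X) = ((x * (w * 1) : G) : G ⧸ X)
        rw [QuotientGroup.eq]
        have : (x * w * x⁻¹ * 1 : G)⁻¹ * (x * (w * 1)) = x := by simp [mul_assoc]
        rw [this]
        exact x.2 }
  have : Finite (MulAction.orbit W ((1 : G) : G ⧸ X)) := hfin
  have : Finite A := hfin
  have hmem : ((1 : G) : G ⧸ X) ∈ A := MulAction.mem_orbit_self _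
  obtain ⟨w, hw, hwX⟩ := SetLike.not_le_iff_exists.1 hWX
  have hmem2 : ((w : G) : G ⧸ X) ∈ A := ⟨⟨w, hw⟩, by
    change ((w * 1 : G) : G ⧸ X) = _
    rw [mul_one]⟩
  -- The orbit of a `p`-group has `p`-power size, and this one contains the distinct cosets `X` and
  -- `wX`.
  have hdvd : p ∣ Nat.card A := by
    obtain ⟨n, hn⟩ := IsPGroup.card_orbit (hY.to_le hWY) ((1 : G) : G ⧸ X)
    have hn : Nat.card A = p ^ n := hn
    rw [hn]
    refine dvd_pow_self p ?_
    rintro rfl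
    rw [pow_zero, Nat.card_eq_one_iff_unique] at hn
    obtain ⟨hs, -⟩ := hn
    have := congrArg Subtype.val (Subsingleton.elim (⟨_, hmem⟩ : A) ⟨_, hmem2⟩)
    have := QuotientGroup.eq.1 this
    exact hwX (by simpa using this)
  have hfix : (⟨_, hmem⟩ : A) ∈ MulAction.fixedPoints X A := by
    intro x
    apply Subtype.ext
    change ((x * 1 : G) : G ⧸ X) = ((1 : G) : G ⧸ X)
    rw [QuotientGroup.eq]
    simp
  -- The `p`-group `X` fixes the trivial coset and `p` divides the size of the set, so it fixes a
  -- second coset `vX`; this says that `v⁻¹ X v ≤ X`.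
  obtain ⟨⟨_, v, rfl⟩, hb, hne⟩ :=
    (hY.to_le hXY).exists_fixed_point_of_prime_dvd_card_of_fixed_point A hdvd hfix
  have hvY : (v : G) ∈ Y := hWY v.2
  obtain ⟨k, hk⟩ := hY ⟨v, hvY⟩
  refine ⟨v, hvY, fun hvX => hne ?_, Subgroup.mem_normalizer_of_pow_eq_one
    (pow_pos (Fact.out : p.Prime).pos k) (congrArg Subtype.val hk) ?_⟩
  · apply Subtype.ext
    change ((1 : G) : G ⧸ X) = ((v * 1 : G) : G ⧸ X)
    rw [QuotientGroup.eq]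
    simpa using hvX
  · intro x hx
    have := congrArg Subtype.val (hb ⟨x⁻¹, inv_mem hx⟩)
    have : ((x⁻¹ * (v * 1) : G) : G ⧸ X) = ((v * 1 : G) : G ⧸ X) := this
    rw [QuotientGroup.eq] at this
    simpa [mul_assoc] using this

/-- Normalizers increase in the `p`-subgroups of a virtually `p`-toral group. -/
theorem IsVirtuallyToral.exists_mem_normalizer [Fact p.Prime] (hG : IsVirtuallyToral p G)
    {X Y : Subgroup G} (hY : IsPGroup p Y) (hXY : X < Y) :
    ∃ y ∈ Y, y ∉ X ∧ y ∈ Subgroup.normalizer (X : Set G) := by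
  obtain ⟨T, hTn, _, hp, hcomm, hfin⟩ := hG.exists_normal
  -- If `Y ∩ T ≤ X`, then `X` has finite index in `Y` and `W = Y` serves. Otherwise `W` is taken
  -- inside `Y ∩ T`, where bounded torsion is finite.
  by_cases hT : Y ⊓ T ≤ X
  · refine Subgroup.exists_mem_normalizer hY hXY.le le_rfl hXY.not_ge ?_ ?_
    · exact fun x hx w hw => mul_mem (mul_mem (hXY.le hx) hw) (inv_mem (hXY.le hx))
    · have : Finite (Y ⧸ T.subgroupOf Y) := inferInstance
      refine (Set.finite_range (fun y : Y ⧸ T.subgroupOf Y => Quotient.liftOn' y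
        (fun y => ((y : G) : G ⧸ X)) ?_)).subset ?_
      · intro a b hab
        rw [QuotientGroup.leftRel_apply] at hab
        rw [QuotientGroup.eq]
        exact hT ⟨(a⁻¹ * b).2, hab⟩
      · rintro _ ⟨y, rfl⟩
        refine ⟨QuotientGroup.mk y, ?_⟩
        change ((y : G) : G ⧸ X) = ((y * 1 : G) : G ⧸ X)
        rw [mul_one]
  · obtain ⟨t, ⟨htY, htT⟩, htX⟩ := SetLike.not_le_iff_exists.1 hT
    obtain ⟨n, hn⟩ := hp ⟨t, htT⟩
    have hn : t ^ p ^ n = 1 := congrArg Subtype.val hn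
    -- The `p ^ n`-torsion of `Y ∩ T` is a subgroup because `T` is abelian, is normalized by `Y`
    -- because `T` is normal, and contains `t ∉ X`.
    let W : Subgroup G :=
      { carrier := {w | w ∈ Y ∧ w ∈ T ∧ w ^ p ^ n = 1}
        one_mem' := ⟨one_mem _, one_mem _, one_pow _⟩
        mul_mem' := by
          rintro a b ⟨ha, ha', ha''⟩ ⟨hb, hb', hb''⟩
          refine ⟨mul_mem ha hb, mul_mem ha' hb', ?_⟩
          rw [Commute.mul_pow (hcomm a ha' b hb'), ha'', hb'', one_mul]
        inv_mem' := by
          rintro a ⟨ha, ha', ha''⟩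
          exact ⟨inv_mem ha, inv_mem ha', by rw [inv_pow, ha'', inv_one]⟩ }
    have hW : Finite W := (hfin n).subset fun w hw => hw.2
    refine Subgroup.exists_mem_normalizer (W := W) hY hXY.le (fun w hw => hw.1)
      (fun h => htX (h ⟨htY, htT, hn⟩)) ?_ (Set.finite_range _)
    rintro x hx w ⟨h1, h2, h3⟩
    refine ⟨mul_mem (mul_mem (hXY.le hx) h1) (inv_mem (hXY.le hx)), hTn.conj_mem w h2 x, ?_⟩
    rw [conj_pow, h3, mul_one, mul_inv_cancel]

/-- A `p`-subgroup of a virtually `p`-toral group that is maximal among the `p`-subgroups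
normalizing it is a Sylow `p`-subgroup. -/
theorem IsVirtuallyToral.eq_sylow [Fact p.Prime] (hG : IsVirtuallyToral p G) {X : Subgroup G}
    (hX : IsPGroup p X)
    (h : ∀ Y : Subgroup G, IsPGroup p Y → X ≤ Y → Y ≤ Subgroup.normalizer (X : Set G) → Y ≤ X) :
    ∃ P : Sylow p G, (P : Subgroup G) = X := by
  obtain ⟨P, hP⟩ := hX.exists_le_sylow
  refine ⟨P, ?_⟩
  by_contra hne
  obtain ⟨y, hy, hyX, hyN⟩ := hG.exists_mem_normalizer P.isPGroup' (lt_of_le_of_ne hP (Ne.symm hne))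
  exact hyX (h (P ⊓ Subgroup.normalizer (X : Set G)) (P.isPGroup'.to_le inf_le_left)
    (le_inf hP Subgroup.le_normalizer) inf_le_right ⟨hy, hyN⟩)

end VirtuallyToral

/-! ### Subgroups of partial groups -/

namespace PSubgroup

open PartialGroup

variable {L : Type u} [PartialGroup L]

theorem coe_list_prod (H : PSubgroup L) (w : List H) :
    ((w.prod : H) : L) = prod (w.map ((↑) : H → L)) := by
  induction w with
  | nil => rfl
  | cons a w ih =>
    have hw : (a : L) :: w.map ((↑) : H → L) ∈ (D : Set (List L)) := by
      refine H.word_mem ((a :: w).map ((↑) : H → L)) fun g hg => ?_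
      obtain ⟨b, -, rfl⟩ := List.mem_map.1 hg
      exact b.2
    have h := contract_prod [(a : L)] (w.map ((↑) : H → L)) [] (by simpa using hw)
    rw [List.prod_cons, coe_mul, ih]
    simpa using h.symm

theorem coe_pow (H : PSubgroup L) (a : H) (n : ℕ) :
    ((a ^ n : H) : L) = prod (List.replicate n (a : L)) := by
  rw [← List.prod_replicate, coe_list_prod, List.map_replicate]

/-- The criterion mentions only the product of `L`, so it does not depend on the subgroup in which
an element is viewed. -/
theorem isPGroup_iff {p : ℕ} {H : PSubgroup L} :
    IsPGroup p H ↔ ∀ a ∈ H, ∃ k : ℕ, prod (List.replicate (p ^ k) a) = unit := by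
  refine ⟨fun h a ha => ?_, fun h a => ?_⟩
  · obtain ⟨k, hk⟩ := h ⟨a, ha⟩
    exact ⟨k, by rw [← H.coe_pow ⟨a, ha⟩, hk, coe_one]⟩
  · obtain ⟨k, hk⟩ := h a a.2
    exact ⟨k, Subtype.ext (by rw [coe_pow, hk, coe_one])⟩

/-- A subgroup of a subgroup of `L`, as a subgroup of `L`. -/
def ofSubgroup (H : PSubgroup L) (X : Subgroup H) : PSubgroup L where
  carrier := {g | ∃ h : g ∈ H, (⟨g, h⟩ : H) ∈ X}
  word_mem w hw := H.word_mem w fun g hg => (hw g hg).1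
  prod_mem w hw := by
    have h : ∃ v : List H, v.map ((↑) : H → L) = w ∧ ∀ a ∈ v, a ∈ X := by
      induction w with
      | nil => exact ⟨[], rfl, by simp⟩
      | cons g w ih =>
        obtain ⟨v, rfl, hv⟩ := ih fun k hk => hw k (by simp [hk])
        obtain ⟨hg, hgX⟩ := hw g (by simp)
        refine ⟨⟨g, hg⟩ :: v, rfl, ?_⟩
        intro a ha
        rcases List.mem_cons.1 ha with rfl | ha
        · exact hgX
        · exact hv a ha
    obtain ⟨v, rfl, hv⟩ := h
    rw [← coe_list_prod]
    exact ⟨v.prod.2, Subgroup.list_prod_mem X hv⟩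
  inv_mem := by
    rintro g ⟨h, hg⟩
    exact ⟨H.inv_mem g h, X.inv_mem hg⟩

theorem isPGroup_ofSubgroup {p : ℕ} {H : PSubgroup L} {X : Subgroup H} (hX : IsPGroup p X) :
    IsPGroup p (H.ofSubgroup X) := by
  rw [isPGroup_iff]
  rintro a ⟨h, ha⟩
  obtain ⟨k, hk⟩ := hX ⟨_, ha⟩
  have hk : (⟨a, h⟩ : H) ^ p ^ k = 1 := congrArg Subtype.val hk
  exact ⟨k, by rw [← H.coe_pow ⟨a, h⟩, hk, coe_one]⟩

/-- The intersection of two subgroups of `L`, as a subgroup of the first one. -/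
def trace (H X : PSubgroup L) : Subgroup H where
  carrier := {h | (h : L) ∈ X}
  one_mem' := X.prod_mem [] (by simp)
  mul_mem' ha hb := X.mul_mem ha hb
  inv_mem' ha := X.inv_mem _ ha

theorem mem_trace {H X : PSubgroup L} {h : H} : h ∈ H.trace X ↔ (h : L) ∈ X := Iff.rfl

theorem isPGroup_trace {p : ℕ} {H X : PSubgroup L} (hX : IsPGroup p X) :
    IsPGroup p (H.trace X) := by
  rintro ⟨a, ha⟩
  obtain ⟨k, hk⟩ := isPGroup_iff.1 hX a ha
  exact ⟨k, Subtype.ext (Subtype.ext (by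
    rw [Subgroup.coe_pow, coe_pow, hk, Subgroup.coe_one, coe_one]))⟩

end PSubgroup

/-! ### Conjugation -/

section Conj

open PartialGroup

variable {L : Type u} [PartialGroup L] {S : PSubgroup L}

theorem conjEq_unit (P : Subgroup S) : ConjEq P unit P :=
  ⟨fun x hx => ⟨x, hx, conjTo_unit _⟩, fun x hx => ⟨x, hx, conjTo_unit _⟩⟩

theorem ConjEq.unique {P Q R : Subgroup S} {g : L} (h : ConjEq P g Q) (k : ConjEq P g R) :
    Q = R := by
  have key : ∀ {Q R : Subgroup S}, ConjEq P g Q → ConjEq P g R → Q ≤ R := by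
    intro Q R h k y hy
    obtain ⟨x, hx, hxy⟩ := h.2 y hy
    obtain ⟨z, hz, hxz⟩ := k.1 x hx
    rwa [Subtype.ext (hxy.eq hxz)]
  exact le_antisymm (key h k) (key k h)

theorem conjEq_coe_iff {P : Subgroup S} {s : S} :
    ConjEq P (s : L) P ↔ s ∈ Subgroup.normalizer (P : Set S) := by
  rw [Subgroup.mem_normalizer_iff'']
  constructor
  · refine fun h x => ⟨fun hx => ?_, fun hx => ?_⟩
    · obtain ⟨y, hy, k⟩ := h.1 x hx
      rwa [Subtype.ext ((S.conjTo_coe s x).eq k)]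
    · obtain ⟨y, hy, k⟩ := h.2 _ hx
      rwa [Subtype.ext ((S.conjTo_coe s x).inj k)]
  · refine fun h => ⟨fun x hx => ⟨_, (h x).1 hx, S.conjTo_coe s x⟩, fun y hy => ?_⟩
    have e : s⁻¹ * (s * y * s⁻¹) * s = y := by group
    refine ⟨s * y * s⁻¹, (h _).2 (e.symm ▸ hy), ?_⟩
    have := S.conjTo_coe s (s * y * s⁻¹)
    rwa [e] at this

end Conj

/-! ### Conjugation between normalizers of objects. -/

namespace PreLocality

open PartialGroup

variable {p : ℕ} {L : Type u} [PartialGroup L] (M : PreLocality p L)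

theorem conjTo_inv {g : L} {a b : M.S} (h : ConjTo g (a : L) (b : L)) :
    ConjTo g ((a⁻¹ : M.S) : L) ((b⁻¹ : M.S) : L) := by
  have h1 : [g⁻¹, ((a⁻¹ : M.S) : L), g] ∈ (D : Set (List L)) := by
    simpa [winv, invol, PSubgroup.coe_inv] using winv_mem h.1
  refine ⟨h1, ?_⟩
  have h2 := prod_winv h.1
  rw [h.2] at h2
  simpa [winv, invol, PSubgroup.coe_inv] using h2

theorem conjEq_comp {P Q R : Subgroup M.S} (hP : P ∈ M.Δ) {g h : L} (hg : ConjEq P g Q)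
    (hh : ConjEq Q h R) : ConjEq P (prod [g, h]) R := by
  refine ⟨M.trans_mul hP hg.1 hh.1, fun z hz => ?_⟩
  obtain ⟨y, hy, l⟩ := hh.2 z hz
  obtain ⟨x, hx, k⟩ := hg.2 y hy
  exact ⟨x, hx, M.conjTo_comp hP hg.1 hh.1 hx k l⟩

theorem conj_word_mem {P Q : Subgroup M.S} (hP : P ∈ M.Δ) {g x : L} (hg : ConjEq P g Q)
    (hx : ConjEq P x P) : [g⁻¹, x, g] ∈ (D : Set (List L)) := by
  have hQ := M.closed P Q g hP hg.1
  rw [M.mem_D_iff]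
  exact ⟨Q, hQ, P, hg.symm, hP, P, hx, hP, Q, hg, hQ⟩

theorem conjEq_of_conjTo {P Q : Subgroup M.S} (hP : P ∈ M.Δ) {g x y : L} (hg : ConjEq P g Q)
    (hx : ConjEq P x P) (h : ConjTo g x y) : ConjEq Q y Q := by
  have hQ := M.closed P Q g hP hg.1
  have h1 := M.conjEq_comp hQ (M.conjEq_comp hQ hg.symm hx) hg
  have e := contract_prod [] [g⁻¹, x] [g] (by simpa using h.1)
  simp only [List.nil_append, List.cons_append] at e
  rwa [← e, h.2] at h1

/-- `x ^ (g h) = (x ^ g) ^ h` for `x ∈ N_L(P)`, `P ∈ Δ`. -/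
theorem conjTo_comp_of_normalizes {P Q R : Subgroup M.S} (hP : P ∈ M.Δ) {g h x y z : L}
    (hg : ConjEq P g Q) (hh : ConjEq Q h R) (hx : ConjEq P x P) (k : ConjTo g x y)
    (l : ConjTo h y z) : ConjTo (prod [g, h]) x z := by
  have hQ := M.closed P Q g hP hg.1
  have hR := M.closed Q R h hQ hh.1
  have hW : [h⁻¹, g⁻¹, x, g, h] ∈ (D : Set (List L)) := by
    rw [M.mem_D_iff]
    exact ⟨_, hR, _, hh.symm, hQ, _, hg.symm, hP, _, hx, hP, _, hg, hQ, _, hh, hR⟩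
  have t : prod [h⁻¹, g⁻¹] = (prod [g, h])⁻¹ := by
    have := prod_winv (M.mul_mem_D hP hg.1 hh.1)
    simpa [winv] using this
  have c1 := same_contract [] [h⁻¹, g⁻¹] [x, g, h] (by simpa using hW)
  have c2 := same_contract [prod [h⁻¹, g⁻¹], x] [g, h] [] (by simpa using c1.1)
  have d1 := same_contract [h⁻¹] [g⁻¹, x, g] [h] (by simpa using hW)
  have e1 := c1.2
  have e2 := c2.2
  have f1 := d1.2
  have m2 := c2.1
  simp only [List.nil_append, List.append_nil, List.cons_append, t, k.2, l.2] at e1 e2 f1 m2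
  exact ⟨m2, by rw [← e2, ← e1, f1]⟩

/-- Conjugation by `g` as a homomorphism `N_L(P) → N_L(P ^ g)`. -/
def conjNormalizer {P Q : Subgroup M.S} (hP : P ∈ M.Δ) (hQ : Q ∈ M.Δ) {g : L}
    (hg : ConjEq P g Q) : M.normalizer P hP →* M.normalizer Q hQ :=
  MonoidHom.mk' (fun x => ⟨prod [g⁻¹, (x : L), g],
      M.conjEq_of_conjTo hP hg x.2 ⟨M.conj_word_mem hP hg x.2, rfl⟩⟩) (by
    intro x y
    apply Subtype.ext
    have hx : ConjEq P (x : L) P := x.2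
    have hy : ConjEq P (y : L) P := y.2
    have hW : [g⁻¹, (x : L), g, g⁻¹, (y : L), g] ∈ (D : Set (List L)) := by
      rw [M.mem_D_iff]
      exact ⟨Q, hQ, P, hg.symm, hP, P, hx, hP, Q, hg, hQ, P, hg.symm, hP, P, hy, hP, Q, hg, hQ⟩
    have c1 := same_cancel [g⁻¹, (x : L)] g [(y : L), g] (by simpa using hW)
    have c2 := same_contract [g⁻¹] [(x : L), (y : L)] [g] (by simpa using c1.1)
    have d1 := same_contract [] [g⁻¹, (x : L), g] [g⁻¹, (y : L), g] (by simpa using hW)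
    have d2 := same_contract [prod [g⁻¹, (x : L), g]] [g⁻¹, (y : L), g] [] (by simpa using d1.1)
    have e1 := c1.2
    have e2 := c2.2
    have f1 := d1.2
    have f2 := d2.2
    simp only [List.nil_append, List.append_nil, List.cons_append] at e1 e2 f1 f2
    exact (e2.symm.trans (e1.symm.trans (f1.trans f2))))

theorem conjTo_conjNormalizer {P Q : Subgroup M.S} (hP : P ∈ M.Δ) (hQ : Q ∈ M.Δ) {g : L}
    (hg : ConjEq P g Q) (x : M.normalizer P hP) :
    ConjTo g (x : L) (M.conjNormalizer hP hQ hg x : L) :=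
  ⟨M.conj_word_mem hP hg x.2, rfl⟩

theorem conjNormalizer_bijective {P Q : Subgroup M.S} (hP : P ∈ M.Δ) (hQ : Q ∈ M.Δ) {g : L}
    (hg : ConjEq P g Q) : Function.Bijective (M.conjNormalizer hP hQ hg) := by
  refine ⟨fun x y h => ?_, fun y => ?_⟩
  · have hx := M.conjTo_conjNormalizer hP hQ hg x
    rw [h] at hx
    exact Subtype.ext (hx.inj (M.conjTo_conjNormalizer hP hQ hg y))
  · refine ⟨M.conjNormalizer hQ hP hg.symm y, Subtype.ext ?_⟩
    have h := (M.conjTo_conjNormalizer hQ hP hg.symm y).symm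
    rw [invol] at h
    exact (M.conjTo_conjNormalizer hP hQ hg _).eq h

/-! ### The closure operator of `Ω` -/

theorem inS_mem {w : List L} {x : L} (h : InS M.S w x) : x ∈ M.S := by
  cases w with
  | nil => exact h
  | cons g w => exact h.1

theorem inS_mul {w : List L} {a b : M.S} (ha : InS M.S w a) (hb : InS M.S w b) :
    InS M.S w ((a * b : M.S) : L) := by
  induction w generalizing a b with
  | nil => exact (a * b).2
  | cons g w ih =>
    obtain ⟨-, c, hc, hc'⟩ := ha
    obtain ⟨-, d, hd, hd'⟩ := hb
    have h := ih (a := ⟨c, M.inS_mem hc'⟩) (b := ⟨d, M.inS_mem hd'⟩) hc' hd'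
    exact ⟨(a * b).2, _, M.conjTo_mul (b := ⟨c, M.inS_mem hc'⟩) (d := ⟨d, M.inS_mem hd'⟩) hc hd, h⟩

theorem inS_inv {w : List L} {a : M.S} (ha : InS M.S w a) : InS M.S w ((a⁻¹ : M.S) : L) := by
  induction w generalizing a with
  | nil => exact (a⁻¹).2
  | cons g w ih =>
    obtain ⟨-, c, hc, hc'⟩ := ha
    exact ⟨(a⁻¹).2, _, M.conjTo_inv (b := ⟨c, M.inS_mem hc'⟩) hc,
      ih (a := ⟨c, M.inS_mem hc'⟩) hc'⟩

theorem inS_one (w : List L) : InS M.S w ((1 : M.S) : L) := by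
  induction w with
  | nil => exact (1 : M.S).2
  | cons g w ih => exact ⟨(1 : M.S).2, _, M.conjTo_one g, ih⟩

/-- The smallest member of `Ω` that contains `P`, as a subgroup of `S`. -/
def star (P : Subgroup M.S) : Subgroup M.S where
  carrier := {x | ∀ w : List L, (∀ a ∈ P, InS M.S w (a : L)) → InS M.S w (x : L)}
  one_mem' w _ := M.inS_one w
  mul_mem' ha hb w hw := M.inS_mul (ha w hw) (hb w hw)
  inv_mem' ha w hw := M.inS_inv (ha w hw)

theorem le_star (P : Subgroup M.S) : P ≤ M.star P := fun x hx _ hw => hw x hx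

theorem star_mono {P Q : Subgroup M.S} (h : P ≤ Q) : M.star P ≤ M.star Q :=
  fun _ hx w hw => hx w fun a ha => hw a (h ha)

theorem star_star (P : Subgroup M.S) : M.star (M.star P) = M.star P :=
  le_antisymm (fun _ hx w hw => hx w fun _ ha => ha w hw) (M.le_star _)

/-- If `Q ≤ S_w`, then `P` lies in `S` of the word `g :: w`, and hence so does its closure. The
reverse inclusion is the same argument for `g⁻¹`. -/
theorem conjEq_star {P Q : Subgroup M.S} {g : L} (h : ConjEq P g Q) :
    ConjEq (M.star P) g (M.star Q) := by
  have key : ∀ {P Q : Subgroup M.S} {g : L}, ConjEq P g Q →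
      ∀ x ∈ M.star P, ∃ y ∈ M.star Q, ConjTo g (x : L) (y : L) := by
    intro P Q g h x hx
    -- The one-letter word shows that conjugation by `g` is defined on the whole closure.
    have h1 : InS M.S [g] (x : L) := hx [g] fun a ha => by
      obtain ⟨b, -, hab⟩ := h.1 a ha
      exact ⟨a.2, b, hab, b.2⟩
    obtain ⟨-, y, hxy, hy⟩ := h1
    refine ⟨⟨y, hy⟩, fun w hw => ?_, hxy⟩
    have h2 : InS M.S (g :: w) (x : L) := hx _ fun a ha => by
      obtain ⟨b, hb, hab⟩ := h.1 a ha
      exact ⟨a.2, b, hab, hw b hb⟩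
    obtain ⟨-, z, hxz, hz⟩ := h2
    exact hxy.eq hxz ▸ hz
  refine ⟨key h, fun y hy => ?_⟩
  obtain ⟨x, hx, hyx⟩ := key h.symm y hy
  have := hyx.symm
  rw [invol] at this
  exact ⟨x, hx, this⟩

theorem coe_star_mem_Omega (P : Subgroup M.S) :
    (Subtype.val '' (M.star P : Set M.S) : Set L) ∈ M.Omega := by
  -- The family is nonempty because the empty word gives `S` itself.
  refine ⟨{w | ∀ a ∈ P, InS M.S w (a : L)}, ⟨[], fun a _ => a.2⟩, Set.ext fun x => ⟨?_, ?_⟩⟩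
  · rintro ⟨x, hx, rfl⟩ w hw
    exact hx w hw
  · intro hx
    exact ⟨⟨x, hx [] fun a _ => a.2⟩, hx, rfl⟩

/-- The closure of `P` as an element of the poset `Ω`. -/
def starOmega (P : Subgroup M.S) : M.Omega := ⟨_, M.coe_star_mem_Omega P⟩

theorem starOmega_le_iff {P Q : Subgroup M.S} :
    M.starOmega P ≤ M.starOmega Q ↔ M.star P ≤ M.star Q :=
  Set.image_subset_image_iff Subtype.val_injective

theorem starOmega_lt_iff {P Q : Subgroup M.S} :
    M.starOmega P < M.starOmega Q ↔ M.star P < M.star Q := by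
  rw [lt_iff_le_not_ge, lt_iff_le_not_ge, starOmega_le_iff, starOmega_le_iff]

/-- If `A` is the intersection of the sets `S_w`, then its conjugate by `g` is the intersection of
the `S` of the words `g⁻¹ :: w`. -/
theorem conj_image_mem_Omega {A : Set L} (hA : A ∈ M.Omega) {g : L}
    (hAg : ∀ x ∈ A, ∃ y ∈ M.S, ConjTo g x y) : {y | ∃ x ∈ A, ConjTo g x y} ∈ M.Omega := by
  obtain ⟨W, ⟨w₀, hw₀⟩, rfl⟩ := hA
  refine ⟨(fun w => g⁻¹ :: w) '' W, ⟨_, w₀, hw₀, rfl⟩, Set.ext fun y => ⟨?_, ?_⟩⟩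
  · rintro ⟨x, hx, hxy⟩ _ ⟨w, hw, rfl⟩
    obtain ⟨z, hz, hxz⟩ := hAg x hx
    exact ⟨hxy.eq hxz ▸ hz, x, hxy.symm, hx w hw⟩
  · intro hy
    obtain ⟨-, x, hyx, -⟩ := hy _ ⟨w₀, hw₀, rfl⟩
    refine ⟨x, fun w hw => ?_, by simpa [invol] using hyx.symm⟩
    obtain ⟨-, z, hyz, hz⟩ := hy _ ⟨w, hw, rfl⟩
    rwa [hyx.eq hyz]

/-- Conjugation by `g` carries a chain of `Ω` below the closure of `P` to one below the closure of
`Q`; strictness survives because conjugation is injective. -/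
theorem height_starOmega_le_of_conjEq {P Q : Subgroup M.S} {g : L} (h : ConjEq P g Q) :
    Order.height (M.starOmega P) ≤ Order.height (M.starOmega Q) := by
  have hs := M.conjEq_star h
  refine Order.height_le fun s hlast => ?_
  have hle : ∀ i, (s i).1 ⊆ (M.starOmega P).1 := fun i =>
    (s.monotone (Fin.le_last i)).trans (le_of_eq hlast)
  have hdef : ∀ i, ∀ x ∈ (s i).1, ∃ y ∈ M.star Q, ConjTo g x (y : L) := by
    intro i x hx
    obtain ⟨z, hz, rfl⟩ := hle i hx
    exact hs.1 z hz
  let t : LTSeries M.Omega :=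
    { length := s.length
      toFun := fun i => ⟨{y | ∃ x ∈ (s i).1, ConjTo g x y},
        M.conj_image_mem_Omega (s i).2 fun x hx =>
          let ⟨y, _, hxy⟩ := hdef i x hx
          ⟨y, y.2, hxy⟩⟩
      step := by
        intro i
        have hi := s.step i
        have hi : (s i.castSucc).1 < (s i.succ).1 := hi
        refine (⟨fun y ⟨x, hx, hxy⟩ => ⟨x, hi.1 hx, hxy⟩, fun hsub => hi.2 fun x hx => ?_⟩ :
          {y | ∃ x ∈ (s i.castSucc).1, ConjTo g x y} < {y | ∃ x ∈ (s i.succ).1, ConjTo g x y})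
        obtain ⟨y, -, hxy⟩ := hdef _ x hx
        obtain ⟨z, hz, hzy⟩ := hsub ⟨x, hx, hxy⟩
        rwa [hxy.inj hzy] }
  refine Order.length_le_height (p := t) ?_
  rintro y ⟨x, hx, hxy⟩
  obtain ⟨z, hz, hxz⟩ := hdef _ x hx
  exact ⟨z, hz, hxz.eq hxy⟩

end PreLocality

/-! ### The dimension function. -/

namespace Locality

open PartialGroup

variable {p : ℕ} {L : Type u} [PartialGroup L] (M : Locality p L)

theorem height_lt_top (A : M.Omega) : Order.height A < ⊤ := by
  obtain ⟨n, hn⟩ := M.finiteDim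
  refine lt_of_le_of_lt (Order.height_le fun s _ => ?_) (ENat.natCast_lt_top n)
  exact_mod_cast hn s

/-- The height of the closure of `P` in `Ω`. -/
noncomputable def dim (P : Subgroup M.S) : ℕ := (Order.height (M.starOmega P)).toNat

theorem coe_dim (P : Subgroup M.S) : (M.dim P : ℕ∞) = Order.height (M.starOmega P) :=
  ENat.natCast_toNat (M.height_lt_top _).ne

theorem exists_dim_le : ∃ n, ∀ P, M.dim P ≤ n := by
  obtain ⟨n, hn⟩ := M.finiteDim
  refine ⟨n, fun P => ?_⟩
  have : (M.dim P : ℕ∞) ≤ n := by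
    rw [coe_dim]
    exact Order.height_le fun s _ => by exact_mod_cast hn s
  exact_mod_cast this

theorem dim_lt {P Q : Subgroup M.S} (h : M.star P < M.star Q) : M.dim P < M.dim Q := by
  have := Order.height_strictMono (M.starOmega_lt_iff.2 h) (M.height_lt_top _)
  rw [← coe_dim, ← coe_dim] at this
  exact_mod_cast this

theorem dim_eq {P Q : Subgroup M.S} {g : L} (h : ConjEq P g Q) : M.dim P = M.dim Q := by
  rw [dim, le_antisymm (M.height_starOmega_le_of_conjEq h)
    (M.height_starOmega_le_of_conjEq h.symm), dim]

theorem dim_star (P : Subgroup M.S) : M.dim (M.star P) = M.dim P := by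
  simp only [dim, PreLocality.starOmega, PreLocality.star_star]

/-- The substitute for comparing orders of finite groups: an inclusion without growth in dimension
is an equality after closure. -/
theorem star_eq_of_le {P Q : Subgroup M.S} (h : P ≤ Q) (hd : M.dim Q ≤ M.dim P) :
    M.star P = M.star Q := by
  by_contra hne
  exact absurd (M.dim_lt (lt_of_le_of_ne (M.star_mono h) hne)) (not_lt.2 hd)

end Locality

/-! ### Sylow subgroups of normalizers of objects -/

namespace PreLocality

open PartialGroup

variable {p : ℕ} {L : Type u} [PartialGroup L] (M : PreLocality p L)

/-- Every `p`-subgroup of `N_L(Q)` can be conjugated into `S`, by an element that conjugates `Q`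
into `S` as well. -/
def Absorbs (Q : Subgroup M.S) : Prop :=
  ∀ X : PSubgroup L, IsPGroup p X → (∀ x ∈ X, ConjEq Q x Q) →
    ∃ h ∈ (Transp Q (⊤ : Subgroup M.S) : Set L), ∀ x ∈ X, ∃ y ∈ M.S, ConjTo h x y

/-- Elements that normalize `Q` also normalize its closure. -/
theorem Absorbs.of_star {Q : Subgroup M.S} (h : M.Absorbs (M.star Q)) : M.Absorbs Q := by
  intro X hX hXQ
  obtain ⟨k, hk, hXk⟩ := h X hX fun x hx => M.conjEq_star (hXQ x hx)
  exact ⟨k, fun x hx => hk x (M.le_star Q hx), hXk⟩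

/-- The `p`-subgroup is moved to `N_L(Q₁)` by `conjNormalizer`, absorbed there by some `k`, and the
product of `g` and `k` does both at once. -/
theorem Absorbs.of_conjEq {Q Q₁ : Subgroup M.S} (hQ : Q ∈ M.Δ) {g : L} (hg : ConjEq Q g Q₁)
    (h : M.Absorbs Q₁) : M.Absorbs Q := by
  intro X hX hXQ
  have hQ₁ := M.closed Q Q₁ g hQ hg.1
  obtain ⟨k, hk, hXk⟩ := h
    ((M.normalizer Q₁ hQ₁).ofSubgroup
      (((M.normalizer Q hQ).trace X).map (M.conjNormalizer hQ hQ₁ hg)))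
    (PSubgroup.isPGroup_ofSubgroup ((PSubgroup.isPGroup_trace hX).map _))
    (by
      rintro x ⟨hx, -⟩
      exact hx)
  refine ⟨prod [g, k], M.trans_mul hQ hg.1 hk, fun x hx => ?_⟩
  have hxN : x ∈ M.normalizer Q hQ := hXQ x hx
  obtain ⟨y, hy, hxy⟩ := hXk (M.conjNormalizer hQ hQ₁ hg ⟨x, hxN⟩)
    ⟨Subtype.mem _, ⟨⟨x, hxN⟩, hx, rfl⟩⟩
  exact ⟨y, hy, M.conjTo_comp_of_normalizes hQ hg (M.conjEq_image k hk) (hXQ x hx)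
    (M.conjTo_conjNormalizer hQ hQ₁ hg ⟨x, hxN⟩) hxy⟩

theorem conjEq_normalizer {Q : Subgroup M.S} (hQ : Q ∈ M.Δ) {x : M.normalizer Q hQ}
    (hx : x ∈ Subgroup.normalizer ((M.normalizer Q hQ).trace M.S : Set (M.normalizer Q hQ))) :
    ConjEq (Subgroup.normalizer (Q : Set M.S)) (x : L) (Subgroup.normalizer (Q : Set M.S)) := by
  have key : ∀ x ∈ Subgroup.normalizer
      ((M.normalizer Q hQ).trace M.S : Set (M.normalizer Q hQ)),
      ∀ r ∈ Subgroup.normalizer (Q : Set M.S), ∃ y ∈ Subgroup.normalizer (Q : Set M.S),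
        ConjTo (x : L) (r : L) (y : L) := by
    intro x hx r hr
    have hrN : (r : L) ∈ M.normalizer Q hQ := conjEq_coe_iff.2 hr
    have h1 : (x⁻¹ * ⟨(r : L), hrN⟩ * x) ∈ (M.normalizer Q hQ).trace M.S :=
      (Subgroup.mem_normalizer_iff''.1 hx _).1 r.2
    exact ⟨⟨_, h1⟩, conjEq_coe_iff.1 (Subtype.mem (x⁻¹ * ⟨(r : L), hrN⟩ * x)),
      PSubgroup.conjTo_coe _ x ⟨(r : L), hrN⟩⟩
  refine ⟨key x hx, fun y hy => ?_⟩
  obtain ⟨z, hz, h⟩ := key x⁻¹ (inv_mem hx) y hy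
  have := h.symm
  rw [PSubgroup.coe_inv, invol] at this
  exact ⟨z, hz, this⟩

/-- If `N_S(Q)` is a Sylow subgroup of `N_L(Q)`, then `Q` absorbs `p`-subgroups. -/
theorem Absorbs.of_sylow {Q : Subgroup M.S} (hQ : Q ∈ M.Δ) [Fact p.Prime]
    (hfin : Finite (Sylow p (M.normalizer Q hQ))) (P : Sylow p (M.normalizer Q hQ))
    (hP : (P : Subgroup (M.normalizer Q hQ)) = (M.normalizer Q hQ).trace M.S) : M.Absorbs Q := by
  intro X hX hXQ
  obtain ⟨R, hR⟩ := (PSubgroup.isPGroup_trace (H := M.normalizer Q hQ) hX).exists_le_sylow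
  -- `R` is a Sylow subgroup containing `X`; finiteness of the set of Sylow subgroups provides `k`
  -- with `R = k P k⁻¹`, so conjugation by `k` sends `X` into `P ≤ S`.
  obtain ⟨k, hk⟩ := MulAction.exists_smul_eq (M.normalizer Q hQ) P R
  refine ⟨(k : L), fun x hx => ?_, fun x hx => ?_⟩
  · obtain ⟨y, -, hxy⟩ := k.2.1 x hx
    exact ⟨y, trivial, hxy⟩
  · have hxN : x ∈ M.normalizer Q hQ := hXQ x hx
    have hxR : (⟨x, hxN⟩ : M.normalizer Q hQ) ∈ R := hR hx
    rw [← hk] at hxR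
    have h1 : k⁻¹ * ⟨x, hxN⟩ * k ∈ (P : Subgroup (M.normalizer Q hQ)) := by
      obtain ⟨z, hz, hzx⟩ := hxR
      have hzx : k * z * k⁻¹ = ⟨x, hxN⟩ := hzx
      rw [← hzx]
      have e : k⁻¹ * (k * z * k⁻¹) * k = z := by group
      rw [e]
      exact hz
    rw [hP] at h1
    exact ⟨_, h1, PSubgroup.conjTo_coe _ k ⟨x, hxN⟩⟩

end PreLocality

/-! ### Absorption of `p`-subgroups and fully normalized objects. -/

namespace Locality

open PartialGroup

variable {p : ℕ} {L : Type u} [PartialGroup L] (M : Locality p L)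

/-- `S` is normal in `N_L(S)`, so `X` and `S` generate a `p`-subgroup containing `S`; maximality of
`S` gives `X ≤ S`, and the unit does the conjugating. -/
theorem absorbs_top : M.Absorbs ⊤ := by
  intro X hX hXS
  let N := M.normalizer ⊤ M.top_mem
  have hSN : ∀ s : M.S, (s : L) ∈ N := fun s => conjEq_self (Subgroup.mem_top s)
  have : (N.trace M.S).Normal := by
    constructor
    intro s hs g
    obtain ⟨y, -, hy⟩ := (show ConjEq ⊤ ((g⁻¹ : N) : L) ⊤ from (g⁻¹ : N).2).1 ⟨s, hs⟩ trivial
    have h := N.conjTo_coe g⁻¹ s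
    rw [inv_inv] at h
    exact PSubgroup.mem_trace.2 (h.eq hy ▸ y.2)
  have hp := (PSubgroup.isPGroup_trace (H := N) hX).to_sup_of_normal_right
    (PSubgroup.isPGroup_trace (H := N) M.isPGroup)
  have h := M.maximal (N.ofSubgroup (N.trace X ⊔ N.trace M.S))
    (fun x hx => ⟨hSN ⟨x, hx⟩, le_sup_right (a := N.trace X) (b := N.trace M.S) hx⟩)
    (PSubgroup.isPGroup_ofSubgroup hp)
  refine ⟨unit, M.unit_mem_trans le_top, fun x hx => ⟨x, ?_, conjTo_unit x⟩⟩
  rw [← h]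
  exact ⟨hXS x hx, le_sup_left (a := N.trace X) (b := N.trace M.S) hx⟩

/-- Put `R = N_S(Q)`. It suffices that a `p`-subgroup `Y` of `N_L(Q)` normalizing `R` lies in `S`.
Absorption for `R` conjugates `Y` and `R` into `S` by some `h`. Maximality of the dimension of `R`
makes `R^h` and `N_S(Q^h)` have the same closure, which therefore contains `Y^h`; undoing `h` puts
`Y` into the closure of `R`, a subgroup of `S`. -/
theorem exists_sylow_eq_trace [Fact p.Prime] {Q : Subgroup M.S} (hQ : Q ∈ M.Δ)
    (hG : IsVirtuallyToral p (M.normalizer Q hQ))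
    (hR : M.Absorbs (Subgroup.normalizer (Q : Set M.S)))
    (hmax : ∀ (g : L) (Q₁ : Subgroup M.S), ConjEq Q g Q₁ →
      M.dim (Subgroup.normalizer (Q₁ : Set M.S)) ≤ M.dim (Subgroup.normalizer (Q : Set M.S))) :
    ∃ P : Sylow p (M.normalizer Q hQ),
      (P : Subgroup (M.normalizer Q hQ)) = (M.normalizer Q hQ).trace M.S := by
  refine hG.eq_sylow (PSubgroup.isPGroup_trace M.isPGroup) fun Y hY _ hYN x hx => ?_
  obtain ⟨h, hh, hYh⟩ := hR _ (PSubgroup.isPGroup_ofSubgroup hY) (by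
    rintro y ⟨hy, hyY⟩
    exact M.conjEq_normalizer hQ (hYN hyY))
  have hQR : Q ≤ Subgroup.normalizer (Q : Set M.S) := Subgroup.le_normalizer
  have hhQ : h ∈ (Transp Q (⊤ : Subgroup M.S) : Set L) := fun z hz => hh z (hQR hz)
  have cQ := M.conjEq_image h hhQ
  have cR := M.conjEq_image h hh
  have hle : M.image h hh ≤ Subgroup.normalizer (M.image h hhQ : Set M.S) := by
    intro y hy
    obtain ⟨r, hr, hry⟩ := cR.2 y hy
    exact conjEq_coe_iff.1 (M.conjEq_of_conjTo hQ cQ (conjEq_coe_iff.2 hr) hry)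
  -- The dimension of `N_S(Q^h)` is at most that of `R` by maximality, and `R` has the dimension of
  -- `R^h`.
  have hstar := M.star_eq_of_le hle ((hmax h _ cQ).trans (M.dim_eq cR).le)
  obtain ⟨z, hz, hxz⟩ := hYh (x : L) ⟨x.2, hx⟩
  have hzN : (⟨z, hz⟩ : M.S) ∈ Subgroup.normalizer (M.image h hhQ : Set M.S) :=
    conjEq_coe_iff.1 (M.conjEq_of_conjTo hQ cQ x.2 hxz)
  -- Closure commutes with conjugation by `h`, so `z` comes from an element `y` of `star R`;
  -- injectivity of conjugation identifies `y` with `x`.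
  obtain ⟨y, -, hyz⟩ := (M.conjEq_star cR).2 ⟨z, hz⟩ (hstar ▸ M.le_star _ hzN)
  exact PSubgroup.mem_trace.2 (hxz.inj hyz ▸ y.2)

theorem absorbs [Fact p.Prime] (hM : M.IsCompact) {Q : Subgroup M.S} (hQ : Q ∈ M.Δ) :
    M.Absorbs Q := by
  obtain ⟨n, hn⟩ := M.exists_dim_le
  -- The dimension is bounded by `n`, so the codimension is a natural number that can be inducted
  -- on.
  induction hm : n - M.dim Q using Nat.strong_induction_on generalizing Q with
  | _ m ih =>
  apply PreLocality.Absorbs.of_star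
  have hQs : M.star Q ∈ M.Δ := M.mem_of_le hQ (M.le_star Q)
  -- Among the conjugates of the closure, `Q₁` is chosen with a normalizer in `S` of maximal
  -- dimension.
  obtain ⟨Q₁, ⟨g, hg⟩, hmin⟩ := WellFounded.has_min
    (measure fun Q₁ : Subgroup M.S => n - M.dim (Subgroup.normalizer (Q₁ : Set M.S))).wf
    {Q₁ | ∃ g, ConjEq (M.star Q) g Q₁} ⟨_, unit, conjEq_unit _⟩
  have hQ₁ := M.closed _ Q₁ g hQs hg.1
  apply PreLocality.Absorbs.of_conjEq M.toPreLocality hQs hg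
  by_cases htop : Q₁ = ⊤
  · rw [htop]
    exact M.absorbs_top
  have hstar : M.star Q₁ = Q₁ := by
    -- `Q₁` is closed, being conjugate to a closed subgroup. Hence the proper inclusion of `Q₁` in
    -- its normalizer raises the dimension strictly, and the induction hypothesis applies to that
    -- normalizer.
    have h := M.conjEq_star hg
    rw [M.star_star] at h
    exact h.unique hg
  have hlt : Q₁ < Subgroup.normalizer (Q₁ : Set M.S) := by
    obtain ⟨y, -, hy, hyN⟩ := hM.proper.normalizerIncreasing Q₁ ⊤ (lt_top_iff_ne_top.2 htop)
    exact SetLike.lt_iff_le_and_exists.2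
      ⟨Subgroup.le_normalizer, y, Subgroup.mem_normalizer_iff''.2 hyN, hy⟩
  have hdim : M.dim Q < M.dim (Subgroup.normalizer (Q₁ : Set M.S)) := by
    rw [← M.dim_star Q, M.dim_eq hg]
    exact M.dim_lt (hstar.symm ▸ hlt.trans_le (M.le_star _))
  have hR : M.Absorbs (Subgroup.normalizer (Q₁ : Set M.S)) := by
    have := hn (Subgroup.normalizer (Q₁ : Set M.S))
    exact ih _ (by omega) (M.mem_of_le hQ₁ hlt.le) rfl
  have hG := hM.toral Q₁ hQ₁
  obtain ⟨P, hP⟩ := M.exists_sylow_eq_trace hQ₁ hG hR (by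
    intro k Q₂ hk
    have h1 := hmin Q₂ ⟨_, M.conjEq_comp hQs hg hk⟩
    have h1 : ¬ (n - M.dim (Subgroup.normalizer (Q₂ : Set M.S)) <
      n - M.dim (Subgroup.normalizer (Q₁ : Set M.S))) := h1
    have h2 := hn (Subgroup.normalizer (Q₁ : Set M.S))
    have h3 := hn (Subgroup.normalizer (Q₂ : Set M.S))
    omega)
  exact PreLocality.Absorbs.of_sylow M.toPreLocality hQ₁ hG.finite_sylow P hP

/-- Every object is conjugate to an object `Q` such that `N_S(Q)` is a Sylow `p`-subgroup of
`N_L(Q)`. -/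
theorem exists_conjEq_sylow [Fact p.Prime] (hM : M.IsCompact) {R : Subgroup M.S}
    (hR : R ∈ M.Δ) : ∃ (g : L) (Q : Subgroup M.S) (hQ : Q ∈ M.Δ), ConjEq R g Q ∧
      ∃ P : Sylow p (M.normalizer Q hQ),
        (P : Subgroup (M.normalizer Q hQ)) = (M.normalizer Q hQ).trace M.S := by
  obtain ⟨P⟩ : Nonempty (Sylow p (M.normalizer R hR)) := inferInstance
  obtain ⟨h, hh, hPh⟩ := M.absorbs hM hR _ (PSubgroup.isPGroup_ofSubgroup P.isPGroup') (by
    rintro x ⟨hx, -⟩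
    exact hx)
  have c := M.conjEq_image h hh
  have hQ := M.image_mem hR h hh
  refine ⟨h, _, hQ, c, ⟨(M.normalizer _ hQ).trace M.S, PSubgroup.isPGroup_trace M.isPGroup, ?_⟩,
    rfl⟩
  intro Y hY hle
  have hbij := M.conjNormalizer_bijective hR hQ c
  -- Seen in `N_L(R)` through the conjugation isomorphism, `N_S(Q)` and any larger `p`-subgroup `Y`
  -- both contain the Sylow subgroup `P`, so both equal it.
  have hPY : (P : Subgroup (M.normalizer R hR)) ≤
      ((M.normalizer _ hQ).trace M.S).comap (M.conjNormalizer hR hQ c) := by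
    intro x hx
    obtain ⟨y, hy, hxy⟩ := hPh x ⟨x.2, hx⟩
    exact PSubgroup.mem_trace.2 ((M.conjTo_conjNormalizer hR hQ c x).eq hxy ▸ hy)
  have h1 := P.is_maximal' (hY.comap_of_injective _ hbij.1)
    (hPY.trans (Subgroup.comap_mono hle))
  have h2 := P.is_maximal' ((PSubgroup.isPGroup_trace M.isPGroup).comap_of_injective _ hbij.1) hPY
  exact Subgroup.comap_injective hbij.2 (h1.trans h2.symm)

/-- An element of `L` that conjugates an object into itself normalizes that object. -/
theorem conjEq_of_transp [Fact p.Prime] (hM : M.IsCompact) {P : Subgroup M.S} (hP : P ∈ M.Δ)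
    {g : L} (hg : g ∈ (Transp P P : Set L)) : ConjEq P g P := by
  have c := M.conjEq_image g hg
  -- `P^g` lies in `P` and has the same dimension, so the closures agree and `g` normalizes the
  -- closure of `P`. There `g` has finite order, so `g⁻¹` is a power of `g` and also conjugates `P`
  -- into itself.
  have hs : M.star (M.image g hg) = M.star P :=
    M.star_eq_of_le (M.image_le g hg) (M.dim_eq c).le
  have cs := M.conjEq_star c
  rw [hs] at cs
  have hPs := M.mem_of_le hP (M.le_star P)
  let N := M.normalizer (M.star P) hPs
  let γ : N := ⟨g, cs⟩
  obtain ⟨n, hn, hγ⟩ := (hM.toral _ hPs).isTorsion γ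
  have hpow : ∀ n : ℕ, ((γ ^ n : N) : L) ∈ (Transp P P : Set L) := by
    intro n
    induction n with
    | zero => exact M.unit_mem_trans le_rfl
    | succ n ih =>
      rw [pow_succ]
      exact M.trans_mul hP ih hg
  have hinv : g⁻¹ ∈ (Transp P P : Set L) := by
    have e : γ ^ (n - 1) = γ⁻¹ := by
      rw [eq_inv_iff_mul_eq_one, ← pow_succ, Nat.sub_add_cancel hn, hγ]
    have := hpow (n - 1)
    rwa [e] at this
  refine ⟨hg, fun y hy => ?_⟩
  obtain ⟨x, hx, h⟩ := hinv y hy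
  have := h.symm
  rw [invol] at this
  exact ⟨x, hx, this⟩

end Locality

/-! ### Morphisms of the transporter category -/

namespace PreLocality

open CategoryTheory PartialGroup

variable {p : ℕ} {L : Type u} [PartialGroup L] {M : PreLocality p L}

theorem hom_ext {P Q : M.TL} {φ ψ : P ⟶ Q} (h : φ.1 = ψ.1) : φ = ψ := Subtype.ext h

theorem comp_val {P Q R : M.TL} (φ : P ⟶ Q) (ψ : Q ⟶ R) : (φ ≫ ψ).1 = prod [φ.1, ψ.1] := rfl

theorem iota_comp_val {P Q R : M.TL} (h : P.grp ≤ Q.grp) (φ : Q ⟶ R) :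
    (iota P Q h ≫ φ).1 = φ.1 := prod_unit_left _

theorem comp_iota_val {P Q R : M.TL} (φ : P ⟶ Q) (h : Q.grp ≤ R.grp) :
    (φ ≫ iota Q R h).1 = φ.1 := prod_unit_right _

theorem conjTo_rhoHom {P Q : M.TL} (φ : P ⟶ Q) (x : P.grp) :
    ConjTo φ.1 ((x : M.S) : L) ((rhoHom φ x : M.S) : L) :=
  M.conjHom_spec φ.1 φ.2 x

/-- The element of `φ` can be cancelled in `L` because its inverse is defined on the image of `P`;
no inverse morphism `Q ⟶ P` is required. -/
theorem mono_of_hom {P Q : M.TL} (φ : P ⟶ Q) : Mono φ := by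
  refine ⟨fun {R} a b h => hom_ext ?_⟩
  have hφ := M.conjEq_image φ.1 φ.2
  have key : ∀ a : R ⟶ P, prod [prod [a.1, φ.1], φ.1⁻¹] = a.1 := by
    intro a
    have w := M.mul3_mem_D R.mem a.2 hφ.1 hφ.symm.1
    have e1 := (same_contract [] [a.1, φ.1] [φ.1⁻¹] (by simpa using w)).2
    have e2 := (same_cancel [a.1] φ.1 [] (by simpa using w)).2
    simp only [List.nil_append, List.append_nil, List.cons_append, prod_single] at e1 e2
    rw [← e1, e2]
  rw [← key a, ← key b]
  have h : prod [a.1, φ.1] = prod [b.1, φ.1] := congrArg Subtype.val h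
  rw [h]

theorem epi_of_hom {P Q : M.TL} (φ : P ⟶ Q) : Epi φ := by
  refine ⟨fun {R} a b h => hom_ext ?_⟩
  have hφ := M.conjEq_image φ.1 φ.2
  have key : ∀ a : Q ⟶ R, prod [φ.1⁻¹, prod [φ.1, a.1]] = a.1 := by
    intro a
    have w := M.mul3_mem_D (M.image_mem P.mem φ.1 φ.2) hφ.symm.1 φ.2 a.2
    have e1 := (same_contract [φ.1⁻¹] [φ.1, a.1] [] (by simpa using w)).2
    have e2 := (same_cancel_inv [] φ.1 [a.1] (by simpa using w)).2
    simp only [List.nil_append, List.append_nil, List.cons_append, prod_single] at e1 e2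
    rw [← e1, e2]
  rw [← key a, ← key b]
  have h : prod [φ.1, a.1] = prod [φ.1, b.1] := congrArg Subtype.val h
  rw [h]

/-- The isomorphism `P → P ^ g` given by `g`. -/
def isoOfConjEq {P Q : M.TL} {g : L} (h : ConjEq P.grp g Q.grp) : P ≅ Q where
  hom := ⟨g, h.1⟩
  inv := ⟨g⁻¹, h.symm.1⟩
  hom_inv_id := hom_ext (mul_inv_unit g)
  inv_hom_id := hom_ext (inv_mul_unit g)

theorem inv_val {P Q : M.TL} (φ : P ≅ Q) : φ.inv.1 = φ.hom.1⁻¹ :=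
  eq_inv_of_mul (M.mul_mem_D Q.mem φ.inv.2 φ.hom.2) (congrArg Subtype.val φ.inv_hom_id)

theorem conjEq_of_iso {P Q : M.TL} (φ : P ≅ Q) : ConjEq P.grp φ.hom.1 Q.grp := by
  refine ⟨φ.hom.2, fun y hy => ?_⟩
  obtain ⟨x, hx, h⟩ := φ.inv.2 y hy
  have := h.symm
  rw [inv_val, invol] at this
  exact ⟨x, hx, this⟩

/-- The bijection between `N_L(P)` and `Aut_T(P)`. -/
def autEquiv (P : M.TL) : M.normalizer P.grp P.mem ≃ Aut P where
  toFun g := isoOfConjEq g.2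
  invFun α := ⟨α.hom.1, conjEq_of_iso α⟩
  left_inv _ := rfl
  right_inv _ := Iso.ext rfl

theorem autEquiv_mul (P : M.TL) (g h : M.normalizer P.grp P.mem) :
    autEquiv P (g * h) = autEquiv P g ≪≫ autEquiv P h := Iso.ext rfl

theorem mem_kerRho_iff_map {P : M.TL} {α : Aut P} : α ∈ kerRho P ↔ M.rho.map α.hom = 𝟙 _ := by
  rw [kerRho, MonoidHom.mem_ker]
  exact ⟨fun h => congrArg Iso.hom h, fun h => Iso.ext h⟩

theorem mem_kerRho {P : M.TL} {α : Aut P} : α ∈ kerRho P ↔ α.hom.1 ∈ M.centralizer P.grp := by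
  rw [mem_kerRho_iff_map]
  constructor
  · intro h x hx
    have h1 := conjTo_rhoHom α.hom ⟨x, hx⟩
    have h2 : rhoHom α.hom = MonoidHom.id P.grp := congrArg Subtype.val h
    rwa [h2] at h1
  · intro h
    apply Subtype.ext
    ext x
    exact (conjTo_rhoHom α.hom x).eq (h x x.2)

theorem centralizer_subset_normalizer {P : Subgroup M.S} (hP : P ∈ M.Δ) {g : L}
    (hg : g ∈ M.centralizer P) : g ∈ M.normalizer P hP :=
  ⟨fun x hx => ⟨x, hx, hg x hx⟩, fun x hx => ⟨x, hx, hg x hx⟩⟩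

/-- Equal conjugation maps have the same image `R`, so both morphisms are an isomorphism onto `R`
followed by one inclusion. The isomorphism for `ψ` followed by the inverse of that for `φ`
centralizes `P`. -/
theorem rhoHom_eq_iff {P Q : M.TL} (φ ψ : P ⟶ Q) :
    rhoHom φ = rhoHom ψ ↔ ∃ α ∈ kerRho P, α.hom ≫ φ = ψ := by
  constructor
  · intro h
    have hφ := M.conjEq_image φ.1 φ.2
    have hψ : ConjEq P.grp ψ.1 (M.image φ.1 φ.2) := by
      have key : ∀ x : P.grp, ConjTo ψ.1 ((x : M.S) : L) ((rhoHom φ x : M.S) : L) := fun x =>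
        h ▸ conjTo_rhoHom ψ x
      refine ⟨fun x hx => ?_, fun y hy => ?_⟩
      · obtain ⟨y, hy, hxy⟩ := hφ.1 x hx
        exact ⟨y, hy, (conjTo_rhoHom φ ⟨x, hx⟩).eq hxy ▸ key ⟨x, hx⟩⟩
      · obtain ⟨x, hx, hxy⟩ := hφ.2 y hy
        exact ⟨x, hx, (conjTo_rhoHom φ ⟨x, hx⟩).eq hxy ▸ key ⟨x, hx⟩⟩
    let R : M.TL := ⟨M.image φ.1 φ.2, M.image_mem P.mem φ.1 φ.2⟩
    let i : P ≅ R := isoOfConjEq hφ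
    let j : P ≅ R := isoOfConjEq hψ
    have hRQ : R.grp ≤ Q.grp := M.image_le φ.1 φ.2
    have hi : i.hom ≫ iota R Q hRQ = φ := hom_ext (comp_iota_val _ _)
    have hj : j.hom ≫ iota R Q hRQ = ψ := hom_ext (comp_iota_val _ _)
    refine ⟨j ≪≫ i.symm, mem_kerRho.2 fun x hx => ?_, ?_⟩
    · have h1 := conjTo_rhoHom φ ⟨x, hx⟩
      have h2 := conjTo_rhoHom ψ ⟨x, hx⟩
      rw [← h] at h2
      exact M.conjTo_comp P.mem hψ.1 hφ.symm.1 hx h2 h1.symm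
    · rw [← hi, ← hj]
      simp
  · rintro ⟨α, hα, rfl⟩
    have : M.rho.map (α.hom ≫ φ) = M.rho.map φ := by
      rw [Functor.map_comp, mem_kerRho_iff_map.1 hα, Category.id_comp]
    exact (congrArg Subtype.val this).symm

/-- The morphisms of the fusion system that are defined on an object, or have an object as image,
are conjugation maps. -/
theorem exists_conjTo_of_generated {P Q : Subgroup M.S} {φ : P →* Q} (hφ : M.fusion.IsHom φ)
    (X Y : Subgroup M.S) (hXP : X ≤ P)
    (hXY : ∀ y : M.S, y ∈ Y ↔ ∃ x : P, (x : M.S) ∈ X ∧ (φ x : M.S) = y)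
    (hΔ : X ∈ M.Δ ∨ Y ∈ M.Δ) :
    ∃ g : L, ∀ x : P, (x : M.S) ∈ X → ConjTo g ((x : M.S) : L) ((φ x : M.S) : L) := by
  have conjEq : ∀ {P Q : Subgroup M.S} {φ : P →* Q} {X Y : Subgroup M.S} {g : L}, X ≤ P →
      (∀ y : M.S, y ∈ Y ↔ ∃ x : P, (x : M.S) ∈ X ∧ (φ x : M.S) = y) →
      (∀ x : P, (x : M.S) ∈ X → ConjTo g ((x : M.S) : L) ((φ x : M.S) : L)) → ConjEq X g Y := by
    intro P Q φ X Y g hXP hXY hg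
    refine ⟨fun x hx => ⟨_, (hXY _).2 ⟨⟨x, hXP hx⟩, hx, rfl⟩, hg ⟨x, hXP hx⟩ hx⟩, fun y hy => ?_⟩
    obtain ⟨x, hx, rfl⟩ := (hXY y).1 hy
    exact ⟨x, hx, hg x hx⟩
  change FusionSystem.Generated _ P Q φ at hφ
  -- The induction follows a subgroup `X` and its exact image `Y`, since objects are not closed
  -- under passage to smaller subgroups. Either end may be the object, because `symm` exchanges
  -- source and image.
  induction hφ generalizing X Y with
  | of φ h =>
    obtain ⟨-, -, g, hg, rfl⟩ := h
    exact ⟨g, fun x _ => M.conjHom_spec g hg x⟩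
  | conj s φ h =>
    refine ⟨(s : L), fun x _ => ?_⟩
    rw [h x]
    exact M.S.conjTo_coe s x
  | @comp P Q R φ ψ _ _ ih ik =>
    let Z : Subgroup M.S := ((X.subgroupOf P).map φ).map Q.subtype
    have hXZ : ∀ z : M.S, z ∈ Z ↔ ∃ x : P, (x : M.S) ∈ X ∧ (φ x : M.S) = z := by
      intro z
      constructor
      · rintro ⟨_, ⟨x, hx, rfl⟩, rfl⟩
        exact ⟨x, hx, rfl⟩
      · rintro ⟨x, hx, rfl⟩
        exact ⟨_, ⟨x, hx, rfl⟩, rfl⟩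
    have hZQ : Z ≤ Q := by
      intro z hz
      obtain ⟨x, -, rfl⟩ := (hXZ z).1 hz
      exact (φ x).2
    have hZY : ∀ y : M.S, y ∈ Y ↔ ∃ z : Q, (z : M.S) ∈ Z ∧ (ψ z : M.S) = y := by
      intro y
      rw [hXY]
      constructor
      · rintro ⟨x, hx, rfl⟩
        exact ⟨φ x, (hXZ _).2 ⟨x, hx, rfl⟩, rfl⟩
      · rintro ⟨z, hz, rfl⟩
        obtain ⟨x, hx, e⟩ := (hXZ _).1 hz
        exact ⟨x, hx, congrArg (fun z => (ψ z : M.S)) (Subtype.ext e)⟩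
    -- Membership in `Δ` spreads along the composite from whichever end has it, each conjugation
    -- just obtained making the next subgroup an object.
    have key : ∃ g h : L, X ∈ M.Δ ∧
        (∀ x : P, (x : M.S) ∈ X → ConjTo g ((x : M.S) : L) ((φ x : M.S) : L)) ∧
        ∀ z : Q, (z : M.S) ∈ Z → ConjTo h ((z : M.S) : L) ((ψ z : M.S) : L) := by
      rcases hΔ with hX | hY
      · obtain ⟨g, hg⟩ := ih X Z hXP hXZ (Or.inl hX)
        have hZ := M.closed X Z g hX (conjEq hXP hXZ hg).1
        obtain ⟨h, hh⟩ := ik Z Y hZQ hZY (Or.inl hZ)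
        exact ⟨g, h, hX, hg, hh⟩
      · obtain ⟨h, hh⟩ := ik Z Y hZQ hZY (Or.inr hY)
        have hZ := M.closed Y Z _ hY (conjEq hZQ hZY hh).symm.1
        obtain ⟨g, hg⟩ := ih X Z hXP hXZ (Or.inr hZ)
        exact ⟨g, h, M.closed Z X _ hZ (conjEq hXP hXZ hg).symm.1, hg, hh⟩
    obtain ⟨g, h, hX, hg, hh⟩ := key
    exact ⟨prod [g, h], fun x hx => M.conjTo_comp hX (conjEq hXP hXZ hg).1 (conjEq hZQ hZY hh).1 hx
      (hg x hx) (hh (φ x) ((hXZ _).2 ⟨x, hx, rfl⟩))⟩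
  | codRestrict φ ψ _ e ih =>
    obtain ⟨g, hg⟩ := ih X Y hXP (by simpa only [e] using hXY) hΔ
    exact ⟨g, fun x hx => by rw [e]; exact hg x hx⟩
  | @symm P Q e _ ih =>
    have hYP : Y ≤ P := by
      intro y hy
      obtain ⟨x, -, rfl⟩ := (hXY y).1 hy
      exact (e.symm x).2
    obtain ⟨g, hg⟩ := ih Y X hYP (by
      intro x
      constructor
      · intro hx
        exact ⟨e.symm ⟨x, hXP hx⟩, (hXY _).2 ⟨⟨x, hXP hx⟩, hx, rfl⟩,
          congrArg Subtype.val (e.apply_symm_apply ⟨x, hXP hx⟩)⟩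
      · rintro ⟨y, hy, rfl⟩
        obtain ⟨z, hz, e'⟩ := (hXY y).1 hy
        have e' : e.symm z = y := Subtype.ext e'
        rw [← e']
        change (e (e.symm z) : M.S) ∈ X
        rwa [e.apply_symm_apply]) hΔ.symm
    refine ⟨g⁻¹, fun x hx => ?_⟩
    have h := hg (e.symm x) ((hXY _).2 ⟨x, hx, rfl⟩)
    change ConjTo g _ ((e (e.symm x) : M.S) : L) at h
    rw [e.apply_symm_apply] at h
    exact h.symm

theorem exists_rhoHom_eq {P Q : M.TL} (ψ : P.grp →* Q.grp) (hψ : M.fusion.IsHom ψ) :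
    ∃ φ : P ⟶ Q, rhoHom φ = ψ := by
  obtain ⟨g, hg⟩ := exists_conjTo_of_generated hψ P.grp (ψ.range.map Q.grp.subtype) le_rfl (by
    intro y
    constructor
    · rintro ⟨_, ⟨x, rfl⟩, rfl⟩
      exact ⟨x, x.2, rfl⟩
    · rintro ⟨x, -, rfl⟩
      exact ⟨_, ⟨x, rfl⟩, rfl⟩) (Or.inl P.mem)
  let φ : P ⟶ Q := ⟨g, fun x hx => ⟨_, (ψ ⟨x, hx⟩).2, hg ⟨x, hx⟩ hx⟩⟩
  refine ⟨φ, ?_⟩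
  ext x
  exact (conjTo_rhoHom φ x).eq (hg x x.2)

theorem isConj_of_conjEq {P Q : Subgroup M.S} (hP : P ∈ M.Δ) {g : L} (h : ConjEq P g Q) :
    M.fusion.IsConj P Q := by
  refine ⟨MulEquiv.ofBijective (M.conjHom g h.1) ⟨M.conjHom_injective g h.1, fun y => ?_⟩,
    FusionSystem.Generated.of _ ⟨hP, M.closed P Q g hP h.1, g, h.1, rfl⟩⟩
  obtain ⟨x, hx, hxy⟩ := h.2 y y.2
  exact ⟨⟨x, hx⟩, Subtype.ext (Subtype.ext ((M.conjHom_spec g h.1 ⟨x, hx⟩).eq hxy))⟩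

/-- With `g` the element of `φ`, both sides are values of the word `(g, g⁻¹, x, g)`, bracketed in
two ways. -/
theorem epsElt_comp {P Q : M.TL} (φ : P ⟶ Q) (x : P.grp) :
    epsElt P x ≫ φ = φ ≫ epsElt Q (rhoHom φ x) := by
  have c := M.conjEq_image φ.1 φ.2
  have hR := M.image_mem P.mem φ.1 φ.2
  have h := conjTo_rhoHom φ x
  have hW : [φ.1, φ.1⁻¹, ((x : M.S) : L), φ.1] ∈ (D : Set (List L)) := by
    rw [M.mem_D_iff]
    exact ⟨P.grp, P.mem, _, c, hR, _, c.symm, P.mem, _, conjEq_self x.2, P.mem, _, c, hR⟩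
  have e1 := (same_cancel [] φ.1 [((x : M.S) : L), φ.1] (by simpa using hW)).2
  have e2 := (same_contract [φ.1] [φ.1⁻¹, ((x : M.S) : L), φ.1] [] (by simpa using hW)).2
  simp only [List.nil_append, List.append_nil, List.cons_append, h.2] at e1 e2
  exact hom_ext (e1.symm.trans e2)

theorem mem_epsImage {P : M.TL} {α : Aut P} : α ∈ epsImage P ↔ α.hom.1 ∈ M.S := by
  constructor
  · rintro ⟨β, rfl⟩
    exact (β.hom.1 : M.S).2
  · intro h
    let s : M.S := ⟨α.hom.1, h⟩
    have hs := Subgroup.mem_normalizer_iff''.1 (conjEq_coe_iff (s := s).1 (conjEq_of_iso α))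
    have hs' := Subgroup.mem_normalizer_iff''.1
      (inv_mem (conjEq_coe_iff (s := s).1 (conjEq_of_iso α)))
    let T : M.TS := ⟨P.grp, P.mem⟩
    let β : Aut T :=
      { hom := ⟨s, fun x hx => (hs x).1 hx⟩
        inv := ⟨s⁻¹, fun x hx => (hs' x).1 hx⟩
        hom_inv_id := Subtype.ext (mul_inv_cancel s)
        inv_hom_id := Subtype.ext (inv_mul_cancel s) }
    exact ⟨β, Iso.ext rfl⟩

/-- The isomorphism from `N_L(P)` to `Aut_T(P)` for the composition order of `Aut`. -/
def normalizerToAut (P : M.TL) : M.normalizer P.grp P.mem →* Aut P :=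
  MonoidHom.mk' (fun g => (autEquiv P g)⁻¹) fun g h => by
    rw [autEquiv_mul, ← mul_inv_rev]
    rfl

theorem normalizerToAut_surjective (P : M.TL) : Function.Surjective (normalizerToAut P) := by
  intro α
  refine ⟨(autEquiv P).symm α⁻¹, ?_⟩
  change (autEquiv P _)⁻¹ = α
  rw [Equiv.apply_symm_apply, inv_inv]

/-- The inversion built into `normalizerToAut` does not matter, since a subgroup is pulled back. -/
theorem comap_epsImage (P : M.TL) :
    (epsImage P).comap (normalizerToAut P) = (M.normalizer P.grp P.mem).trace M.S := by
  ext g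
  rw [Subgroup.mem_comap]
  change (autEquiv P g)⁻¹ ∈ _ ↔ _
  rw [inv_mem_iff, mem_epsImage]
  rfl

/-- Extension of an isomorphism to overgroups in which its source and target are normal. -/
theorem exists_extension {P Q : M.TL} (φ : P ≅ Q) {P₁ Q₁ : Subgroup M.S} (hP : P.grp ≤ P₁)
    (hQ : Q.grp ≤ Q₁) (hPn : (P.grp.subgroupOf P₁).Normal)
    (h : ∀ s : GTransp P.grp P.grp, (s : M.S) ∈ P₁ → ∃ t : GTransp Q.grp Q.grp, (t : M.S) ∈ Q₁ ∧
      φ.inv ≫ epsHom P P s ≫ φ.hom = epsHom Q Q t) :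
    ∃ (hP₁ : P₁ ∈ M.Δ) (hQ₁ : Q₁ ∈ M.Δ) (φ₁ : (⟨P₁, hP₁⟩ : M.TL) ⟶ ⟨Q₁, hQ₁⟩),
      iota P ⟨P₁, hP₁⟩ hP ≫ φ₁ = φ.hom ≫ iota Q ⟨Q₁, hQ₁⟩ hQ := by
  have hP₁ := M.mem_of_le P.mem hP
  have hQ₁ := M.mem_of_le Q.mem hQ
  -- The extension is the same element of `L`. Normality of `P` in `P₁` puts `x ∈ P₁` into `N_S(P)`,
  -- so its conjugate is defined, and the hypothesis identifies it with an element of `Q₁`.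
  suffices hT : φ.hom.1 ∈ (Transp P₁ Q₁ : Set L) from ⟨hP₁, hQ₁, ⟨φ.hom.1, hT⟩,
    hom_ext ((iota_comp_val (Q := ⟨P₁, hP₁⟩) (R := ⟨Q₁, hQ₁⟩) hP ⟨φ.hom.1, hT⟩).trans
      (comp_iota_val (R := ⟨Q₁, hQ₁⟩) φ.hom hQ).symm)⟩
  intro x hx
  have c := conjEq_of_iso φ
  have hxN : x ∈ Subgroup.normalizer (P.grp : Set M.S) :=
    (Subgroup.normal_subgroupOf_iff_le_normalizer hP).1 hPn hx
  obtain ⟨t, ht, e⟩ := h ⟨x, fun y hy => (Subgroup.mem_normalizer_iff''.1 hxN y).1 hy⟩ hx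
  have hW := M.conj_word_mem P.mem c (conjEq_coe_iff.2 hxN)
  refine ⟨t, ht, hW, ?_⟩
  have e1 := contract_prod [φ.hom.1⁻¹] [(x : L), φ.hom.1] [] (by simpa using hW)
  have e2 : prod [φ.inv.1, prod [(x : L), φ.hom.1]] = ((t : M.S) : L) := congrArg Subtype.val e
  rw [inv_val] at e2
  simp only [List.append_nil, List.cons_append, List.nil_append] at e1
  rw [e1, e2]

/-- Extension of a compatible sequence of morphisms to the union of their sources. -/
theorem exists_iUnion_extension (P : ℕ → M.TL) (hle : ∀ i, (P i).grp ≤ (P (i + 1)).grp)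
    (ψ : ∀ i, P i ⟶ M.topObj) (hψ : ∀ i, ψ i = iota (P i) (P (i + 1)) (hle i) ≫ ψ (i + 1)) :
    ∃ U : M.TL, (U.grp : Set M.S) = ⋃ i, ((P i).grp : Set M.S) ∧
      ∃ (hU : ∀ i, (P i).grp ≤ U.grp) (χ : U ⟶ M.topObj), ∀ i, ψ i = iota (P i) U (hU i) ≫ χ := by
  have hmono : Monotone fun i => (P i).grp := monotone_nat_of_le_succ hle
  have hU := Subgroup.coe_iSup_of_directed hmono.directed_le
  -- Composition with an inclusion does not change the underlying element, so the whole sequence is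
  -- a single element of `L`.
  have hval : ∀ i, (ψ i).1 = (ψ 0).1 := by
    intro i
    induction i with
    | zero => rfl
    | succ i ih =>
      rw [← ih, hψ i]
      exact (iota_comp_val (hle i) (ψ (i + 1))).symm
  let U : M.TL := ⟨⨆ i, (P i).grp, M.mem_of_le (P 0).mem (le_iSup (fun i => (P i).grp) 0)⟩
  have hPU : ∀ i, (P i).grp ≤ U.grp := le_iSup fun i => (P i).grp
  suffices hT : (ψ 0).1 ∈ (Transp U.grp M.topObj.grp : Set L) from ⟨U, hU, hPU, ⟨(ψ 0).1, hT⟩,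
    fun i => hom_ext ((hval i).trans (iota_comp_val (hPU i) (⟨(ψ 0).1, hT⟩ : U ⟶ M.topObj)).symm)⟩
  intro x hx
  have hx : x ∈ ⋃ i, ((P i).grp : Set M.S) := hU ▸ hx
  obtain ⟨i, hi⟩ := Set.mem_iUnion.1 hx
  rw [← hval i]
  exact (ψ i).2 x hi

end PreLocality

namespace Locality

open CategoryTheory PreLocality

variable {p : ℕ} {L : Type u} [PartialGroup L] (M : Locality p L)

/-- The Sylow property of `N_S(Q)` in `N_L(Q)` is carried to `Aut Q` along the surjection
`normalizerToAut`, under which the image of `ε` pulls back to `N_S(Q)` with the same index. -/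
theorem exists_sylow_epsImage [Fact p.Prime] (hM : M.IsCompact) (R : M.TL) :
    ∃ P : M.TL, M.fusion.IsConj R.grp P.grp ∧
      IsPGroup p (epsImage P) ∧ (epsImage P).FiniteIndex ∧ (epsImage P).index.Coprime p := by
  obtain ⟨g, Q, hQ, c, P, hP⟩ := M.exists_conjEq_sylow hM R.mem
  have hG := hM.toral Q hQ
  have hfin := hG.finiteIndex_sylow P
  have hsurj := normalizerToAut_surjective (⟨Q, hQ⟩ : M.TL)
  have hcomap := (comap_epsImage (⟨Q, hQ⟩ : M.TL)).trans hP.symm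
  have hindex := Subgroup.index_comap_of_surjective (epsImage (⟨Q, hQ⟩ : M.TL)) hsurj
  rw [hcomap] at hindex
  refine ⟨⟨Q, hQ⟩, isConj_of_conjEq R.mem c, ?_, ⟨?_⟩, ?_⟩
  · rw [← Subgroup.map_comap_eq_self_of_surjective hsurj (epsImage (⟨Q, hQ⟩ : M.TL)), hcomap]
    exact P.isPGroup'.map _
  · rw [← hindex]
    exact hfin.index_ne_zero
  · rw [← hindex]
    exact ((Nat.Prime.coprime_iff_not_dvd Fact.out).2 P.not_dvd_index).symm

end Locality

open CategoryTheory PreLocality in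
theorem propositionA8 {p : ℕ} [Fact p.Prime] {L : Type u} [PartialGroup L] (M : Locality p L)
    (hM : M.IsCompact) :
    -- `Mor_T(P, P) = Aut_T(P)` is identified with `N_L(P)`, and `Ker(ρ_P)` with `C_L(P)`
    (∀ P : M.TL, (∀ φ : P ⟶ P, IsIso φ) ∧
      ∃ e : M.normalizer P.grp P.mem ≃ Aut P,
        (∀ g, (e g).hom.1 = (g : L)) ∧
        (∀ g h, e (g * h) = e g ≪≫ e h) ∧
        (∀ g, e g ∈ kerRho P ↔ (g : L) ∈ M.centralizer P.grp) ∧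
        (∀ g ∈ M.centralizer P.grp, g ∈ M.normalizer P.grp P.mem)) ∧
    -- (A1)
    ((∀ P : M.TS, (M.eps.obj P).grp = P.grp) ∧ (∀ P : M.TL, (M.rho.obj P).grp = P.grp)) ∧
    -- (A2)
    (∀ P Q : M.TL,
      (∀ α ∈ kerRho P, ∀ φ : P ⟶ Q, α.hom ≫ φ = φ → α = 1) ∧
      (∀ ψ : P.grp →* Q.grp, M.fusion.IsHom ψ → ∃ φ : P ⟶ Q, rhoHom φ = ψ) ∧
      (∀ φ ψ : P ⟶ Q, rhoHom φ = rhoHom ψ ↔ ∃ α ∈ kerRho P, α.hom ≫ φ = ψ) ∧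
      (∀ β ∈ kerRho Q, ∀ φ : P ⟶ Q, φ ≫ β.hom = φ → β = 1)) ∧
    -- (B)
    (∀ P Q : M.TL, Function.Injective (epsHom P Q) ∧
      ∀ (s : GTransp P.grp Q.grp) (x : P.grp),
        (rhoHom (epsHom P Q s) x : M.S) = (s : M.S)⁻¹ * x * s) ∧
    -- (C)
    (∀ (P Q : M.TL) (φ : P ⟶ Q) (x : P.grp), epsElt P x ≫ φ = φ ≫ epsElt Q (rhoHom φ x)) ∧
    -- (I)
    (∀ R : M.TL, ∃ P : M.TL, M.fusion.IsConj R.grp P.grp ∧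
      IsPGroup p (epsImage P) ∧ (epsImage P).FiniteIndex ∧ (epsImage P).index.Coprime p) ∧
    -- (II)
    (∀ (P Q : M.TL) (φ : P ≅ Q) (P₁ Q₁ : Subgroup M.S) (hP : P.grp ≤ P₁) (hQ : Q.grp ≤ Q₁),
      (P.grp.subgroupOf P₁).Normal → (Q.grp.subgroupOf Q₁).Normal →
      (∀ s : GTransp P.grp P.grp, (s : M.S) ∈ P₁ → ∃ t : GTransp Q.grp Q.grp, (t : M.S) ∈ Q₁ ∧
        φ.inv ≫ epsHom P P s ≫ φ.hom = epsHom Q Q t) →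
      ∃ (hP₁ : P₁ ∈ M.Δ) (hQ₁ : Q₁ ∈ M.Δ) (φ₁ : (⟨P₁, hP₁⟩ : M.TL) ⟶ ⟨Q₁, hQ₁⟩),
        iota P ⟨P₁, hP₁⟩ hP ≫ φ₁ = φ.hom ≫ iota Q ⟨Q₁, hQ₁⟩ hQ) ∧
    -- (III)
    (∀ (P : ℕ → M.TL) (hle : ∀ i, (P i).grp ≤ (P (i + 1)).grp) (ψ : ∀ i, P i ⟶ M.topObj),
      (∀ i, ψ i = iota (P i) (P (i + 1)) (hle i) ≫ ψ (i + 1)) →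
      ∃ U : M.TL, (U.grp : Set M.S) = ⋃ i, ((P i).grp : Set M.S) ∧
        ∃ (hU : ∀ i, (P i).grp ≤ U.grp) (χ : U ⟶ M.topObj),
          ∀ i, ψ i = iota (P i) U (hU i) ≫ χ) := by

  refine ⟨fun P => ⟨fun φ => ?_, autEquiv P, fun _ => rfl, autEquiv_mul P, fun g => mem_kerRho,
      fun g hg => centralizer_subset_normalizer P.mem hg⟩, ⟨fun _ => rfl, fun _ => rfl⟩,
    fun P Q => ⟨fun α _ φ h => ?_, fun ψ hψ => exists_rhoHom_eq ψ hψ, rhoHom_eq_iff,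
      fun β _ φ h => ?_⟩, fun P Q => ⟨fun s t h => ?_, fun s x => ?_⟩,
    fun P Q φ x => epsElt_comp φ x, M.exists_sylow_epsImage hM,
    fun P Q φ P₁ Q₁ hP hQ hPn _ h => exists_extension φ hP hQ hPn h, exists_iUnion_extension⟩
  · exact (isoOfConjEq (M.conjEq_of_transp hM P.mem φ.2)).isIso_hom
  · have := mono_of_hom φ
    exact Iso.ext ((cancel_mono φ).1 (h.trans (Category.id_comp φ).symm))
  · have := epi_of_hom φ
    exact Iso.ext ((cancel_epi φ).1 (h.trans (Category.comp_id φ).symm))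
  · have h : ((s : M.S) : L) = ((t : M.S) : L) := congrArg (fun φ : P ⟶ Q => φ.1) h
    exact Subtype.ext (Subtype.ext h)
  · exact Subtype.ext ((conjTo_rhoHom (epsHom P Q s) x).eq (M.S.conjTo_coe s x))
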